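/- Let $\mathcal H_{\mathcal A}$ be a Hilbert space of finite dimension $d\ge 1$. An observable $A=\sum_a a\,|a\rangle\langle a|$ on $\mathcal H_{\mathcal A}$ has $d$ distinct real eigenvalues and an orthonormal eigenbasis. For a state (density operator) $\rho$ on $\mathcal H_{\mathcal A}\otimes\mathcal H_{\mathcal B}$, with $\mathcal H_{\mathcal B}$ finite-dimensional, put $\Phi_A(\rho)=\sum_a(|a\rangle\langle a|\otimes 1)\rho(|a\rangle\langle a|\otimes 1)$ and $\mathcal M_A^\epsilon(\rho)=(1-\epsilon)\rho+\epsilon\Phi_A(\rho)$. Let $\|X\|_p=(\operatorname{Tr}|X|^p)^{1/p}$, $d_p(\rho,\sigma)=\|\sigma-\rho\|_p$, $d_{Tr}=d_1$, $d_{HS}=d_2$, $F(\rho,\sigma)=\|\sqrt\sigma\sqrt\rho\|_1^2$, $d_{Bu}(\rho,\sigma)=(2-2\sqrt{F(\rho,\sigma)})^{1/2}$ and $d_{He}(\rho,\sigma)=\|\sqrt\sigma-\sqrt\rho\|_2$. Consider the losses $$L_A^{Bu}(\rho)=d^{-1/2}d_{Bu}^2(\rho,\Phi_A(\rho)),\qquad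 L_A^{He}(\rho)=d^{-1/2}d_{He}^2(\rho,\Phi_A(\rho)),$$ $$L_A^{Tr}(\rho)=d_{Tr}\big(\rho,\tfrac1d\Phi_A(\rho)\big)-\tfrac{d-1}{d},\qquad L_A^{HS}(\rho)=\tfrac1d\,d_{HS}^2(\rho,\Phi_A(\rho)),$$ $$L_A^{p}(\rho)=d_p^p\big(\rho\otimes|e_0\rangle\langle e_0|,\Phi_A(\rho)\otimes\tfrac{1}{d}1_{\mathcal E}\big)-d_p^p\big(\rho\otimes|e_0\rangle\langle e_0|,\rho\otimes\tfrac{1}{d}1_{\mathcal E}\big)\quad(1<p<\infty,\ p\ne 2),$$ where $\mathcal H_{\mathcal E}$ has dimension $d$ and orthonormal basis vector $e_0$. For each of them let $\mathfrak R^{\max}$ be the supremum of $L_A(\rho)$ over all observables $A$ on $\mathcal H_{\mathcal A}$, all finite-dimensional $\mathcal H_{\mathcal B}$ and all states $\rho$, and let $\mathfrak R_A(\rho)=\mathfrak R^{\max}-L_A(\rho)$. (I) Both $\mathfrak R=\mathfrak R^{Bu}$ and $\mathfrak R=\mathfrak R^{He}$ satisfy, for all observables and states: * Axiom 1: $0\le\mathfrak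 R_A(\rho)\le\mathfrak R_A(\mathcal M_A^\epsilon(\rho))\le\mathfrak R_A(\Phi_A(\rho))=\mathfrak R^{\max}$ for $0\le\epsilon\le1$, and $\mathfrak R_A(\rho)=\mathfrak R^{\max}$ if and only if $\rho=\Phi_A(\rho)$. * Axiom 2(a): $\mathfrak R_A(\operatorname{Tr}_{\mathcal X}\rho)\ge\mathfrak R_A(\rho)$ for a tensor factor $\mathcal X$ of $\mathcal B$. * Axiom 2(b): $\mathfrak R_A(\rho\otimes\sigma)=\mathfrak R_A(\rho)$ for every state $\sigma$ of an additional system. * Axiom 3: $\mathfrak R_X(\rho)+\mathfrak R_Y(\rho)\le2\mathfrak R^{\max}$ for any two observables $X,Y$ on $\mathcal H_{\mathcal A}$, with equality if and only if $\rho=\Phi_X(\rho)=\Phi_Y(\rho)$. Equality holds if $\rho=\frac1d1_{\mathcal A}\otimes\rho_{\mathcal B}$. If $d=2$, or if $X$ and $Y$ have no common invariant subspace other than $0$ and $\mathcal H_{\mathcal A}$, then equality holds only when $[X,Y]=0$ or $\rho=\frac1d1_{\mathcal A}\otimes\rho_{\mathcal B}$. * Axiom 4: $\mathfrak R_A(\sum_ip_i\rho_i)\ge\sum_ip_i\mathfrak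 R_A(\rho_i)$ for every finite ensemble $\{p_i,\rho_i\}$. (II) For Bures and for Hellinger, $\mathfrak R^{\max}=\frac{2}{\sqrt d}\big(1-\frac1{\sqrt d}\big)$, and for every observable $A$ this value is the loss $L_A$ of the maximally entangled state of $\mathcal H_{\mathcal A}\otimes\mathcal H_{\mathcal A}$. (III) If $d\ge2$, the quantifiers of the other distances are not monotones: $\mathfrak R^{Tr}$ violates Axiom 1 (its maximum is also reached at states with $\rho\ne\Phi_A(\rho)$), and $\mathfrak R^{HS}$ and every $\mathfrak R^{p}$ ($1<p<\infty$, $p\neq2$) violate Axiom 2(b). -/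

import Mathlib

open scoped Kronecker ComplexOrder

namespace QRealism

noncomputable section

/-- A density matrix on the finite-dimensional Hilbert space with orthonormal basis `n`. -/
def IsState {n : Type} [Fintype n] (ρ : Matrix n n ℂ) : Prop :=
  ρ.PosSemidef ∧ ρ.trace = 1

/-- Square root of a positive semidefinite matrix. -/
def msqrt {n : Type} [Fintype n] [DecidableEq n] (M : Matrix n n ℂ) : Matrix n n ℂ :=
  cfc Real.sqrt M

/-- The modulus `|M| = √(M† M)`. -/
def mabs {n : Type} [Fintype n] [DecidableEq n] (M : Matrix n n ℂ) : Matrix n n ℂ :=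
  msqrt (M.conjTranspose * M)

/-- The Schatten norm `‖M‖_p = (Tr |M|^p)^(1/p)`. -/
def schattenNorm {n : Type} [Fintype n] [DecidableEq n] (p : ℝ) (M : Matrix n n ℂ) : ℝ :=
  ((cfc (fun x : ℝ => x ^ p) (mabs M)).trace.re) ^ (1 / p)

/-- The Schatten distance `d_p(ρ, σ) = ‖σ - ρ‖_p`. -/
def dSchatten {n : Type} [Fintype n] [DecidableEq n] (p : ℝ) (ρ σ : Matrix n n ℂ) : ℝ :=
  schattenNorm p (σ - ρ)

/-- The Uhlmann fidelity `F(ρ, σ) = ‖√σ √ρ‖₁²`. -/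
def fidelity {n : Type} [Fintype n] [DecidableEq n] (ρ σ : Matrix n n ℂ) : ℝ :=
  schattenNorm 1 (msqrt σ * msqrt ρ) ^ 2

/-- The Bures distance. -/
def dBures {n : Type} [Fintype n] [DecidableEq n] (ρ σ : Matrix n n ℂ) : ℝ :=
  Real.sqrt (2 - 2 * Real.sqrt (fidelity ρ σ))

/-- The quantum Hellinger distance. -/
def dHellinger {n : Type} [Fintype n] [DecidableEq n] (ρ σ : Matrix n n ℂ) : ℝ :=
  schattenNorm 2 (msqrt σ - msqrt ρ)

/-- An observable with `d` distinct outcomes on a `d`-dimensional space: an orthonormal basis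
(the columns of a unitary matrix) together with pairwise distinct real eigenvalues. -/
structure Observable (a : Type) [Fintype a] [DecidableEq a] where
  basis : Matrix.unitaryGroup a ℂ
  value : a → ℝ
  value_injective : Function.Injective value

/-- The rank-one projector `|k⟩⟨k|` onto the `k`-th eigenvector. -/
def Observable.proj {a : Type} [Fintype a] [DecidableEq a] (A : Observable a) (k : a) :
    Matrix a a ℂ :=
  Matrix.of fun i j => (A.basis : Matrix a a ℂ) i k * star ((A.basis : Matrix a a ℂ) j k)

/-- The Hermitian matrix `∑ₖ (value k) |k⟩⟨k|`. -/
def Observable.toMatrix {a : Type} [Fintype a] [DecidableEq a] (A : Observable a) :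
    Matrix a a ℂ :=
  ∑ k, (A.value k : ℂ) • A.proj k

/-- The non-selective projective measurement
`Φ_A(ρ) = ∑ₖ (A_k ⊗ 1) ρ (A_k ⊗ 1)` on `H_A ⊗ H_B`. -/
def measure {a b : Type} [Fintype a] [DecidableEq a] [Fintype b] [DecidableEq b]
    (A : Observable a) (ρ : Matrix (a × b) (a × b) ℂ) : Matrix (a × b) (a × b) ℂ :=
  ∑ k, (A.proj k ⊗ₖ (1 : Matrix b b ℂ)) * ρ * (A.proj k ⊗ₖ (1 : Matrix b b ℂ))

/-- The monitoring map `(1 - ε) ρ + ε Φ_A(ρ)`. -/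
def monitor {a b : Type} [Fintype a] [DecidableEq a] [Fintype b] [DecidableEq b]
    (A : Observable a) (ε : ℝ) (ρ : Matrix (a × b) (a × b) ℂ) : Matrix (a × b) (a × b) ℂ :=
  ((1 - ε : ℝ) : ℂ) • ρ + (ε : ℂ) • measure A ρ

/-- The partial trace over the last factor of `H_A ⊗ (H_B ⊗ H_X)`. -/
def traceOut {a b x : Type} [Fintype x] (ρ : Matrix (a × b × x) (a × b × x) ℂ) :
    Matrix (a × b) (a × b) ℂ :=
  Matrix.of fun i j => ∑ k, ρ (i.1, i.2, k) (j.1, j.2, k)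

/-- The reduced state on `H_B` of a state on `H_A ⊗ H_B`. -/
def reducedB {a b : Type} [Fintype a] (ρ : Matrix (a × b) (a × b) ℂ) : Matrix b b ℂ :=
  Matrix.of fun i j => ∑ k, ρ (k, i) (k, j)

/-- `ρ ⊗ σ`, regarded as a state on `H_A ⊗ (H_B ⊗ H_C)`. -/
def adjoin {a b c : Type} (ρ : Matrix (a × b) (a × b) ℂ) (σ : Matrix c c ℂ) :
    Matrix (a × b × c) (a × b × c) ℂ :=
  Matrix.reindex (Equiv.prodAssoc a b c) (Equiv.prodAssoc a b c) (ρ ⊗ₖ σ)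

/-- The density matrix of `d^(-1/2) ∑ₖ |k⟩|k⟩` in `H_A ⊗ H_A`. -/
def maxEntangled (a : Type) [Fintype a] [DecidableEq a] : Matrix (a × a) (a × a) ℂ :=
  Matrix.of fun i j => if i.1 = i.2 ∧ j.1 = j.2 then (Fintype.card a : ℂ)⁻¹ else 0

/-- A real functional of an observable on a fixed `H_A` and an operator on `H_A ⊗ H_B`, for all
finite-dimensional `H_B`. -/
abbrev Quantifier (a : Type) [Fintype a] [DecidableEq a] : Type 1 :=
  ∀ (b : Type) [Fintype b] [DecidableEq b], Observable a → Matrix (a × b) (a × b) ℂ → ℝ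

section Quantifiers

variable (a : Type) [Fintype a] [DecidableEq a]

/-- `d_E^(-1/2) d_Bu²(ρ, Φ_A(ρ))`, where `d_E = d_A`. -/
def lossBures : Quantifier a := fun _ _ _ A ρ =>
  1 / Real.sqrt (Fintype.card a) * dBures ρ (measure A ρ) ^ 2

/-- `d_E^(-1/2) d_He²(ρ, Φ_A(ρ))`. -/
def lossHellinger : Quantifier a := fun _ _ _ A ρ =>
  1 / Real.sqrt (Fintype.card a) * dHellinger ρ (measure A ρ) ^ 2

/-- `d_Tr(ρ, Φ_A(ρ)/d_E) - (d_E - 1)/d_E`. -/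
def lossTrace : Quantifier a := fun _ _ _ A ρ =>
  dSchatten 1 ρ ((Fintype.card a : ℂ)⁻¹ • measure A ρ)
    - ((Fintype.card a : ℝ) - 1) / (Fintype.card a : ℝ)

/-- `d_E^(-1) d_HS²(ρ, Φ_A(ρ))`. -/
def lossHilbertSchmidt : Quantifier a := fun _ _ _ A ρ =>
  1 / (Fintype.card a : ℝ) * dSchatten 2 ρ (measure A ρ) ^ 2

/-- The increase of conditional information for `d_p^p`: the difference of
`d_p^p(ρ ⊗ |e₀⟩⟨e₀|, Φ_A(ρ) ⊗ 1/d_E)` and `d_p^p(ρ ⊗ |e₀⟩⟨e₀|, ρ ⊗ 1/d_E)`, with `ρ` and `e₀`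
acting on `H_A ⊗ H_B` and on the environment `H_E`, a copy of `H_A`. -/
def lossSchatten (p : ℝ) (e₀ : a) : Quantifier a := fun _ _ _ A ρ =>
  dSchatten p (ρ ⊗ₖ Matrix.single e₀ e₀ (1 : ℂ))
      (measure A ρ ⊗ₖ ((Fintype.card a : ℂ)⁻¹ • (1 : Matrix a a ℂ))) ^ p
    - dSchatten p (ρ ⊗ₖ Matrix.single e₀ e₀ (1 : ℂ))
      (ρ ⊗ₖ ((Fintype.card a : ℂ)⁻¹ • (1 : Matrix a a ℂ))) ^ p

variable {a}

/-- The maximal realism: the largest loss over all observables on `H_A`, all `H_B` and all states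
on `H_A ⊗ H_B`. -/
def maxRealism (L : Quantifier a) : ℝ :=
  sSup {r : ℝ | ∃ (m : ℕ) (A : Observable a) (ρ : Matrix (a × Fin m) (a × Fin m) ℂ),
    IsState ρ ∧ r = L (Fin m) A ρ}

/-- The realism `R_A(ρ) = R^max - L_A(ρ)`. -/
def realism (L : Quantifier a) : Quantifier a := fun b _ _ A ρ =>
  maxRealism L - L b A ρ

/-- Realism and measurements. The maximum is reached exactly at the states that already have
realism for the observable. -/
def MeasurementAxiom (R : Quantifier a) (Rmax : ℝ) : Prop :=
  ∀ (b : Type) [Fintype b] [DecidableEq b] (A : Observable a)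
    (ρ : Matrix (a × b) (a × b) ℂ), IsState ρ →
    (∀ ε : ℝ, 0 ≤ ε → ε ≤ 1 →
      0 ≤ R b A ρ ∧ R b A ρ ≤ R b A (monitor A ε ρ) ∧
      R b A (monitor A ε ρ) ≤ R b A (measure A ρ)) ∧
    R b A (measure A ρ) = Rmax ∧
    (R b A ρ = Rmax ↔ measure A ρ = ρ)

/-- Discarding a subsystem does not reduce realism. -/
def DiscardAxiom (R : Quantifier a) : Prop :=
  ∀ (b x : Type) [Fintype b] [DecidableEq b] [Fintype x] [DecidableEq x] (A : Observable a)
    (ρ : Matrix (a × b × x) (a × b × x) ℂ), IsState ρ →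
    R (b × x) A ρ ≤ R b A (traceOut ρ)

/-- Adding an uncorrelated system does not change realism. -/
def UncorrelatedAxiom (R : Quantifier a) : Prop :=
  ∀ (b c : Type) [Fintype b] [DecidableEq b] [Fintype c] [DecidableEq c] (A : Observable a)
    (ρ : Matrix (a × b) (a × b) ℂ) (σ : Matrix c c ℂ), IsState ρ → IsState σ →
    R (b × c) A (adjoin ρ σ) = R b A ρ

/-- The state is maximally mixed on `H_A` and uncorrelated: `ρ = 1/d_A ⊗ ρ_B`. -/
def IsMixedOnA {b : Type} (ρ : Matrix (a × b) (a × b) ℂ) : Prop :=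
  ρ = ((Fintype.card a : ℂ)⁻¹ • (1 : Matrix a a ℂ)) ⊗ₖ reducedB ρ

/-- `X` and `Y` have no common invariant subspace other than `0` and `H_A`: an orthogonal
projection commuting with both is trivial. -/
def NoCommonBlock (X Y : Observable a) : Prop :=
  ∀ P : Matrix a a ℂ, P.IsHermitian → P * P = P →
    Commute P X.toMatrix → Commute P Y.toMatrix → P = 0 ∨ P = 1

/-- Uncertainty relation, with its cases of equality. -/
def UncertaintyAxiom (R : Quantifier a) (Rmax : ℝ) : Prop :=
  ∀ (b : Type) [Fintype b] [DecidableEq b] (X Y : Observable a)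
    (ρ : Matrix (a × b) (a × b) ℂ), IsState ρ →
    R b X ρ + R b Y ρ ≤ 2 * Rmax ∧
    (R b X ρ + R b Y ρ = 2 * Rmax ↔ measure X ρ = ρ ∧ measure Y ρ = ρ) ∧
    (IsMixedOnA ρ → R b X ρ + R b Y ρ = 2 * Rmax) ∧
    (Fintype.card a = 2 ∨ NoCommonBlock X Y → R b X ρ + R b Y ρ = 2 * Rmax →
      Commute X.toMatrix Y.toMatrix ∨ IsMixedOnA ρ)

/-- Realism is concave. -/
def MixingAxiom (R : Quantifier a) : Prop :=
  ∀ (b : Type) [Fintype b] [DecidableEq b] (A : Observable a) (ι : Type) [Fintype ι]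
    (p : ι → ℝ) (ρ : ι → Matrix (a × b) (a × b) ℂ),
    (∀ i, 0 ≤ p i) → ∑ i, p i = 1 → (∀ i, IsState (ρ i)) →
    ∑ i, p i * R b A (ρ i) ≤ R b A (∑ i, (p i : ℂ) • ρ i)

/-- All axioms of a monotone of violations of quantum realism. -/
structure IsMonotone (R : Quantifier a) (Rmax : ℝ) : Prop where
  measurement : MeasurementAxiom R Rmax
  discard : DiscardAxiom R
  uncorrelated : UncorrelatedAxiom R
  uncertainty : UncertaintyAxiom R Rmax
  mixing : MixingAxiom R

end Quantifiers

end

end QRealism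

namespace QRealism

noncomputable section

set_option linter.unusedSectionVars false

open Matrix
open scoped MatrixOrder

/-! ### Square roots and moduli of matrices -/

section Roots

variable {n m : Type} [Fintype n] [DecidableEq n] [Fintype m] [DecidableEq m]

/-! Both positive results rest on one observation: the Bures and Hellinger losses have the form `(2
- 2 f(ρ, Φ_A(ρ))) / √d`, with `f` the root fidelity `‖√σ √ρ‖₁` or the affinity `Tr √ρ √σ`. The
structure `IsSimilarity` collects what the axioms need from `f`. The deep property is that `f`
cannot decrease under a partial trace. Applied to block diagonal operators, whose block index is a
classical register, it gives joint concavity, hence convexity of the loss. This yields mixing, and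
also monitoring, because the loss vanishes after a measurement. The case `f = 1` only for equal
states identifies the states of zero loss.

For the root fidelity, monotonicity is Uhlmann's theorem: `f` is the largest overlap of two
purifications, and a purification of `ρ` is, after regrouping indices, one of its partial trace. For
the affinity it is Ando's argument: the geometric mean of two commuting positive matrices dominates
every Hermitian off-diagonal block compatible with them, which is tested on a compression of `√ρ ⊗
√σᵀ`.

The maximum comes from the pinching inequality `ρ ≤ d Φ_A(ρ)`. With operator monotonicity of the
root it gives `f ≥ 1/√d`, first for the affinity and then for the larger root fidelity. The
maximally entangled state attains the bound, because its measured version is `1/d` times a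
projection that fixes the state.

Equality in the uncertainty relation means that both losses vanish. Then every block of `ρ` between
basis vectors of `H_B` commutes with both observables, and a Schur argument makes the blocks scalar.

The counterexamples mix the uniform superposition with the maximally mixed state, next to a
maximally mixed bystander; the standard measurement sends all of them to the same state. For the
trace distance, `ρ ≥ Φ_A(ρ)/d` already forces zero loss. For the other distances, the loss is a
function of `α` times `|b|^(1 - p)`, so enlarging the bystander changes it as soon as that function
is nonzero somewhere. -/

theorem continuousOn_spectrum (f : ℝ → ℝ) (M : Matrix n n ℂ) : ContinuousOn f (spectrum ℝ M) :=
  M.finite_real_spectrum.continuousOn f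

theorem posSemidef_cfc {f : ℝ → ℝ} {M : Matrix n n ℂ} (hf : ∀ x ∈ spectrum ℝ M, 0 ≤ f x) :
    (cfc f M).PosSemidef :=
  Matrix.nonneg_iff_posSemidef.1 (cfc_nonneg hf)

theorem spectrum_nonneg {M : Matrix n n ℂ} (hM : M.PosSemidef) {x : ℝ} (hx : x ∈ spectrum ℝ M) :
    0 ≤ x :=
  spectrum_nonneg_of_nonneg (Matrix.nonneg_iff_posSemidef.2 hM) hx

theorem posSemidef_msqrt (M : Matrix n n ℂ) : (msqrt M).PosSemidef :=
  posSemidef_cfc fun _ _ => Real.sqrt_nonneg _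

theorem msqrt_mul_self {M : Matrix n n ℂ} (hM : M.PosSemidef) : msqrt M * msqrt M = M := by
  have hsa : IsSelfAdjoint M := hM.isHermitian
  unfold msqrt
  rw [← cfc_mul _ _ M (continuousOn_spectrum _ _) (continuousOn_spectrum _ _)]
  conv_rhs => rw [← cfc_id ℝ M]
  exact cfc_congr fun x hx => Real.mul_self_sqrt (spectrum_nonneg hM hx)

/-- Uniqueness of the positive root. The formulas below for roots and moduli of multiples, tensor
products, reindexings and block diagonals come from exhibiting a positive matrix with the right
square. -/
theorem msqrt_eq {M S : Matrix n n ℂ} (hS : S.PosSemidef) (h : S * S = M) : msqrt M = S := by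
  have hsa : IsSelfAdjoint S := hS.isHermitian
  have h2 : M = cfc (fun x : ℝ => x * x) S := by
    rw [cfc_mul (fun x : ℝ => x) (fun x : ℝ => x) S, cfc_id' ℝ S, h]
  rw [h2, msqrt, ← cfc_comp' Real.sqrt (fun x : ℝ => x * x) S
    (((S.finite_real_spectrum).image _).continuousOn _) (continuousOn_spectrum _ _)]
  conv_rhs => rw [← cfc_id ℝ S]
  exact cfc_congr fun x hx => Real.sqrt_mul_self (spectrum_nonneg hS hx)

theorem posSemidef_mabs (M : Matrix n n ℂ) : (mabs M).PosSemidef := posSemidef_msqrt _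

theorem mabs_mul_self (M : Matrix n n ℂ) : mabs M * mabs M = Mᴴ * M :=
  msqrt_mul_self (posSemidef_conjTranspose_mul_self M)

theorem mabs_eq {M S : Matrix n n ℂ} (hS : S.PosSemidef) (h : S * S = Mᴴ * M) : mabs M = S :=
  msqrt_eq hS h

theorem mabs_eq_self {M : Matrix n n ℂ} (hM : M.PosSemidef) : mabs M = M :=
  mabs_eq hM (by rw [hM.isHermitian.eq])

theorem posSemidef_real_smul {M : Matrix n n ℂ} (hM : M.PosSemidef) {c : ℝ} (hc : 0 ≤ c) :
    ((c : ℂ) • M).PosSemidef :=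
  hM.smul (by exact_mod_cast hc)

theorem msqrt_smul {M : Matrix n n ℂ} (hM : M.PosSemidef) {c : ℝ} (hc : 0 ≤ c) :
    msqrt ((c : ℂ) • M) = (Real.sqrt c : ℂ) • msqrt M := by
  refine msqrt_eq (posSemidef_real_smul (posSemidef_msqrt M) (Real.sqrt_nonneg c)) ?_
  rw [smul_mul_smul_comm, msqrt_mul_self hM]
  congr 1
  exact_mod_cast Real.mul_self_sqrt hc

theorem mabs_smul (M : Matrix n n ℂ) {c : ℝ} (hc : 0 ≤ c) :
    mabs ((c : ℂ) • M) = (c : ℂ) • mabs M := by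
  refine mabs_eq (posSemidef_real_smul (posSemidef_mabs M) hc) ?_
  rw [smul_mul_smul_comm, mabs_mul_self, conjTranspose_smul, smul_mul_smul_comm]
  simp

theorem msqrt_kronecker {M : Matrix n n ℂ} {N : Matrix m m ℂ} (hM : M.PosSemidef)
    (hN : N.PosSemidef) : msqrt (M ⊗ₖ N) = msqrt M ⊗ₖ msqrt N := by
  refine msqrt_eq ((posSemidef_msqrt M).kronecker (posSemidef_msqrt N)) ?_
  rw [← mul_kronecker_mul, msqrt_mul_self hM, msqrt_mul_self hN]

theorem mabs_kronecker (M : Matrix n n ℂ) (N : Matrix m m ℂ) :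
    mabs (M ⊗ₖ N) = mabs M ⊗ₖ mabs N := by
  refine mabs_eq ((posSemidef_mabs M).kronecker (posSemidef_mabs N)) ?_
  rw [← mul_kronecker_mul, mabs_mul_self, mabs_mul_self, conjTranspose_kronecker,
    mul_kronecker_mul]

theorem msqrt_submatrix {M : Matrix n n ℂ} (hM : M.PosSemidef) (e : m ≃ n) :
    msqrt (M.submatrix e e) = (msqrt M).submatrix e e := by
  refine msqrt_eq ((posSemidef_msqrt M).submatrix e) ?_
  rw [submatrix_mul_equiv, msqrt_mul_self hM]

theorem mabs_submatrix (M : Matrix n n ℂ) (e : m ≃ n) :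
    mabs (M.submatrix e e) = (mabs M).submatrix e e := by
  refine mabs_eq ((posSemidef_mabs M).submatrix e) ?_
  rw [submatrix_mul_equiv, mabs_mul_self, conjTranspose_submatrix, submatrix_mul_equiv]

theorem posSemidef_blockDiagonal {M : m → Matrix n n ℂ} (hM : ∀ i, (M i).PosSemidef) :
    (blockDiagonal M).PosSemidef := by
  have h : blockDiagonal M =
      (blockDiagonal fun i => msqrt (M i))ᴴ * blockDiagonal fun i => msqrt (M i) := by
    rw [blockDiagonal_conjTranspose, ← blockDiagonal_mul]
    congr 1
    funext i
    rw [(posSemidef_msqrt (M i)).isHermitian.eq, msqrt_mul_self (hM i)]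
  rw [h]
  exact posSemidef_conjTranspose_mul_self _

theorem msqrt_blockDiagonal {M : m → Matrix n n ℂ} (hM : ∀ i, (M i).PosSemidef) :
    msqrt (blockDiagonal M) = blockDiagonal fun i => msqrt (M i) := by
  refine msqrt_eq (posSemidef_blockDiagonal fun i => posSemidef_msqrt (M i)) ?_
  rw [← blockDiagonal_mul]
  simp only [msqrt_mul_self (hM _)]

theorem mabs_blockDiagonal (M : m → Matrix n n ℂ) :
    mabs (blockDiagonal M) = blockDiagonal fun i => mabs (M i) := by
  refine mabs_eq (posSemidef_blockDiagonal fun i => posSemidef_mabs (M i)) ?_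
  rw [← blockDiagonal_mul, blockDiagonal_conjTranspose, ← blockDiagonal_mul]
  simp only [mabs_mul_self]

end Roots

/-! ### Contractions, polar decomposition and the trace norm -/

section Contractions

variable {n m l : Type} [Fintype n] [DecidableEq n] [Fintype m] [DecidableEq m]
  [Fintype l] [DecidableEq l]

/-- `K†K ≤ 1`. -/
def IsContraction (K : Matrix m n ℂ) : Prop := (1 - Kᴴ * K).PosSemidef

/-- The two Schur complements of the block matrix with diagonal blocks `1` and off-diagonal blocks
`K`, `Kᴴ` are `1 - Kᴴ * K` and `1 - K * Kᴴ`; each is positive exactly when the block matrix is. -/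
theorem IsContraction.conjTranspose {K : Matrix m n ℂ} (hK : IsContraction K) :
    IsContraction Kᴴ := by
  let : Invertible (1 : Matrix m m ℂ) := invertibleOne
  let : Invertible (1 : Matrix n n ℂ) := invertibleOne
  have h1 := PosDef.fromBlocks₁₁ (A := (1 : Matrix m m ℂ)) K (1 : Matrix n n ℂ) PosDef.one
  have h2 := PosDef.fromBlocks₂₂ (1 : Matrix m m ℂ) K (D := (1 : Matrix n n ℂ)) PosDef.one
  rw [inv_one, Matrix.mul_one] at h1 h2
  unfold IsContraction at *
  rw [conjTranspose_conjTranspose]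
  exact h2.1 (h1.2 hK)

theorem IsContraction.mul {K : Matrix m n ℂ} {L : Matrix n l ℂ} (hK : IsContraction K)
    (hL : IsContraction L) : IsContraction (K * L) := by
  have h := (PosSemidef.conjTranspose_mul_mul_same hK L).add hL
  have e : Lᴴ * (1 - Kᴴ * K) * L + (1 - Lᴴ * L) = 1 - (K * L)ᴴ * (K * L) := by
    rw [conjTranspose_mul]
    simp only [Matrix.mul_sub, Matrix.sub_mul, Matrix.mul_one, Matrix.mul_assoc]
    abel
  rwa [e] at h

theorem isContraction_one : IsContraction (1 : Matrix n n ℂ) := by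
  simp [IsContraction, PosSemidef.zero]

/-- Douglas' factorization through a positive semidefinite matrix. -/
theorem exists_contraction_mul {A : Matrix m n ℂ} {S : Matrix n n ℂ} (hS : S.PosSemidef)
    (h : (S * S - Aᴴ * A).PosSemidef) :
    ∃ V : Matrix m n ℂ, IsContraction V ∧ A = V * S ∧ (S * S = Aᴴ * A → S = Vᴴ * A) := by
  have hsa : IsSelfAdjoint S := hS.isHermitian
  -- Since `0⁻¹ = 0`, this is the pseudo-inverse of `S`, and `T * S` is the projection onto its
  -- range. The factor sought is `A * T`.
  set T : Matrix n n ℂ := cfc (fun x : ℝ => x⁻¹) S with hT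
  have hTH : Tᴴ = T := (cfc_predicate (fun x : ℝ => x⁻¹) S : IsSelfAdjoint T)
  have hTS : T * S = S * T := by
    have := (cfc_commute_cfc (fun x : ℝ => x⁻¹) id S).eq
    rwa [cfc_id ℝ S] at this
  have hSTS : S * T * S = S := by
    have : cfc (fun x : ℝ => x * x⁻¹ * x) S = S * T * S := by
      rw [cfc_mul _ _ S (continuousOn_spectrum _ _) (continuousOn_spectrum _ _),
        cfc_mul _ _ S (continuousOn_spectrum _ _) (continuousOn_spectrum _ _), cfc_id' ℝ S]
    rw [← this]
    conv_rhs => rw [← cfc_id' ℝ S]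
    exact cfc_congr fun x _ => mul_inv_mul_cancel x
  have hSH : Sᴴ = S := hS.isHermitian.eq
  have hTSS : T * S * S = S := by rw [hTS, hSTS]
  have hPH : (T * S)ᴴ = T * S := by rw [conjTranspose_mul, hSH, hTH, hTS]
  have hPP : T * S * (T * S) = T * S := by
    rw [Matrix.mul_assoc, ← Matrix.mul_assoc S, hSTS]
  have hSP : S * (1 - T * S) = 0 := by
    rw [Matrix.mul_sub, Matrix.mul_one, ← Matrix.mul_assoc, hSTS, sub_self]
  -- `A` vanishes on the kernel of `S`: compressing `S * S - Aᴴ * A ≥ 0` to that kernel leaves minus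
  -- a Gram matrix.
  have hAP : A * (1 - T * S) = 0 := by
    have h1 := PosSemidef.conjTranspose_mul_mul_same h (1 - T * S)
    have h2 : (1 - T * S)ᴴ * (S * S - Aᴴ * A) * (1 - T * S)
        = -((A * (1 - T * S))ᴴ * (A * (1 - T * S))) := by
      rw [Matrix.mul_assoc, Matrix.sub_mul, Matrix.mul_assoc S, hSP, conjTranspose_mul]
      simp only [Matrix.mul_zero, Matrix.mul_assoc, zero_sub, Matrix.mul_neg]
    rw [h2] at h1
    have h3 := posSemidef_conjTranspose_mul_self (A * (1 - T * S))
    have h4 := le_antisymm (Matrix.le_iff.2 (by simpa using h1 :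
      (0 - (A * (1 - T * S))ᴴ * (A * (1 - T * S))).PosSemidef))
      (Matrix.nonneg_iff_posSemidef.2 h3)
    exact conjTranspose_mul_self_eq_zero.1 h4
  refine ⟨A * T, ?_, ?_, fun h' => ?_⟩
  -- `1 - (A * T)ᴴ * (A * T)` splits into the compression of the hypothesis by `T` and the
  -- projection onto the kernel of `S`.
  · have h1 := (PosSemidef.conjTranspose_mul_mul_same h T).add
      (posSemidef_conjTranspose_mul_self (1 - T * S))
    have h2 : Tᴴ * (S * S - Aᴴ * A) * T + (1 - T * S)ᴴ * (1 - T * S)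
        = 1 - (A * T)ᴴ * (A * T) := by
      have h3 : Tᴴ * (S * S) * T = T * S := by
        rw [hTH, Matrix.mul_assoc, Matrix.mul_assoc S, ← hTS, ← Matrix.mul_assoc, hPP]
      rw [Matrix.mul_sub, Matrix.sub_mul, h3, conjTranspose_sub, conjTranspose_one, hPH,
        Matrix.mul_sub, Matrix.sub_mul, Matrix.sub_mul, Matrix.mul_one, Matrix.one_mul,
        Matrix.mul_one, hPP, conjTranspose_mul]
      simp only [Matrix.mul_assoc]
      abel
    rwa [h2] at h1
  · rw [Matrix.mul_sub, Matrix.mul_one, sub_eq_zero, ← Matrix.mul_assoc] at hAP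
    exact hAP
  · rw [conjTranspose_mul, hTH, Matrix.mul_assoc, ← h', ← Matrix.mul_assoc, hTSS]

/-- With `R = √H`, expand `‖R - C R‖₂² ≥ 0` and bound `‖C R‖₂² ≤ ‖R‖₂²`. -/
theorem re_trace_contraction_mul_le {C H : Matrix n n ℂ} (hC : IsContraction C)
    (hH : H.PosSemidef) : (C * H).trace.re ≤ H.trace.re := by
  set R := msqrt H with hR
  have hRH : Rᴴ = R := (posSemidef_msqrt H).isHermitian.eq
  have hRR : R * R = H := msqrt_mul_self hH
  have h1 := Complex.le_def.1 (posSemidef_conjTranspose_mul_self (R - C * R)).trace_nonneg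
  have h2 := Complex.le_def.1 (PosSemidef.conjTranspose_mul_mul_same hC R).trace_nonneg
  have h3 : (C * H).trace = (R * C * R).trace := by
    rw [Matrix.mul_assoc, trace_mul_comm R, Matrix.mul_assoc, hRR]
  have h4 : (R * Cᴴ * R).trace.re = (R * C * R).trace.re := by
    have : R * Cᴴ * R = (R * C * R)ᴴ := by
      simp only [conjTranspose_mul, hRH, Matrix.mul_assoc]
    rw [this, trace_conjTranspose]
    rfl
  have e1 : (R - C * R)ᴴ * (R - C * R) = H - R * C * R - R * Cᴴ * R + R * (Cᴴ * C) * R := by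
    simp only [conjTranspose_sub, conjTranspose_mul, hRH, Matrix.mul_sub, Matrix.sub_mul,
      Matrix.mul_assoc, hRR]
    abel
  have e2 : Rᴴ * (1 - Cᴴ * C) * R = H - R * (Cᴴ * C) * R := by
    simp only [hRH, Matrix.mul_sub, Matrix.sub_mul, Matrix.mul_one, hRR]
  rw [e1] at h1
  rw [e2] at h2
  simp only [trace_sub, trace_add, Complex.sub_re, Complex.add_re, Complex.zero_re] at h1 h2
  rw [h3]
  linarith [h1.1, h2.1]

theorem re_trace_contraction_mul_le_mabs {K M : Matrix n n ℂ} (hK : IsContraction K) :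
    (K * M).trace.re ≤ (mabs M).trace.re := by
  obtain ⟨V, hV, hM, -⟩ := exists_contraction_mul (A := M) (posSemidef_mabs M)
    (by rw [mabs_mul_self, sub_self]; exact PosSemidef.zero)
  have h := re_trace_contraction_mul_le (hK.mul hV) (posSemidef_mabs M)
  rwa [Matrix.mul_assoc, ← hM] at h

/-- Together with the preceding bound this gives the variational formula for the trace norm: the
maximum of `Re Tr (K M)` over contractions is `Tr |M|`, attained at the adjoint of the polar factor.
-/
theorem exists_contraction_trace_eq (M : Matrix n n ℂ) :
    ∃ K : Matrix n n ℂ, IsContraction K ∧ mabs M = K * M := by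
  obtain ⟨V, hV, -, h⟩ := exists_contraction_mul (A := M) (posSemidef_mabs M)
    (by rw [mabs_mul_self, sub_self]; exact PosSemidef.zero)
  exact ⟨Vᴴ, hV.conjTranspose, h (mabs_mul_self M)⟩

end Contractions

/-! ### Operator monotonicity of the root and maximality of the geometric mean -/

section Monotonicity

variable {n m : Type} [Fintype n] [DecidableEq n] [Fintype m] [DecidableEq m]

/-- The square root is operator monotone. -/
theorem posSemidef_sub_of_sq {H K : Matrix n n ℂ} (hH : H.IsHermitian) (hK : K.PosSemidef)
    (h : (K * K - H * H).PosSemidef) : (K - H).PosSemidef := by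
  have hD : (K - H).IsHermitian := hK.isHermitian.sub hH
  rw [hD.posSemidef_iff_eigenvalues_nonneg]
  intro i
  by_contra hneg
  simp only [Pi.zero_apply, not_le] at hneg
  set lam := hD.eigenvalues i
  set v : n → ℂ := (hD.eigenvectorBasis i).ofLp with hv
  have hev : (K - H) *ᵥ v = (lam : ℂ) • v := by
    simpa using hD.mulVec_eigenvectorBasis i
  have hvv : star v ⬝ᵥ v = 1 := by
    have := hD.eigenvectorBasis.orthonormal.1 i
    rw [EuclideanSpace.norm_eq, Real.sqrt_eq_one] at this
    simp only [dotProduct, Pi.star_apply, Complex.star_def, Complex.conj_mul']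
    exact_mod_cast this
  have hHv : H *ᵥ v = K *ᵥ v - (lam : ℂ) • v := by
    rw [← hev, sub_mulVec]; abel
  -- For an eigenvalue `lam < 0` of `K - H`, substituting `H v = K v - lam v` makes `⟨v, (K² - H²)
  -- v⟩` strictly negative, since `⟨v, K v⟩ ≥ 0`.
  have h1 : star v ⬝ᵥ ((K * K - H * H) *ᵥ v)
      = 2 * lam * (star v ⬝ᵥ (K *ᵥ v)) - (lam : ℂ) ^ 2 := by
    have hs : star v ⬝ᵥ (H *ᵥ (H *ᵥ v)) = star (H *ᵥ v) ⬝ᵥ (H *ᵥ v) := by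
      rw [star_mulVec, hH.eq, dotProduct_mulVec]
    have hs' : star v ⬝ᵥ (K *ᵥ (K *ᵥ v)) = star (K *ᵥ v) ⬝ᵥ (K *ᵥ v) := by
      rw [star_mulVec, hK.isHermitian.eq, dotProduct_mulVec]
    have hs'' : star (K *ᵥ v) ⬝ᵥ v = star v ⬝ᵥ (K *ᵥ v) := by
      rw [star_mulVec, hK.isHermitian.eq, dotProduct_mulVec]
    rw [sub_mulVec, dotProduct_sub, ← mulVec_mulVec, ← mulVec_mulVec, hs, hs', hHv, star_sub,
      star_smul]
    simp only [sub_dotProduct, dotProduct_sub, smul_dotProduct, dotProduct_smul, hs'', hvv,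
      smul_eq_mul, Complex.star_def, Complex.conj_ofReal]
    ring
  have h2 := Complex.le_def.1 (h.dotProduct_mulVec_nonneg v)
  have h3 := Complex.le_def.1 (hK.dotProduct_mulVec_nonneg v)
  rw [h1] at h2
  have h4 : ((2 * (lam : ℂ) * (star v ⬝ᵥ (K *ᵥ v)) - (lam : ℂ) ^ 2)).re
      = 2 * lam * (star v ⬝ᵥ (K *ᵥ v)).re - lam ^ 2 := by
    rw [← Complex.ofReal_pow, Complex.sub_re, Complex.ofReal_re, mul_assoc, mul_assoc]
    simp
  have h5 := h2.1
  rw [h4] at h5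
  have h6 := h3.1
  simp only [Complex.zero_re] at h5 h6
  nlinarith [mul_nonneg (neg_nonneg.2 hneg.le) h6, pow_pos (neg_pos.2 hneg) 2]

theorem msqrt_mono {M N : Matrix n n ℂ} (hM : M.PosSemidef) (hN : N.PosSemidef)
    (h : (N - M).PosSemidef) : (msqrt N - msqrt M).PosSemidef :=
  posSemidef_sub_of_sq (posSemidef_msqrt M).isHermitian (posSemidef_msqrt N)
    (by rwa [msqrt_mul_self hM, msqrt_mul_self hN])

theorem posSemidef_mul_of_commute {S T : Matrix n n ℂ} (hS : S.PosSemidef) (hT : T.PosSemidef)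
    (h : Commute S T) : (S * T).PosSemidef :=
  Matrix.nonneg_iff_posSemidef.1 (Commute.mul_nonneg (Matrix.nonneg_iff_posSemidef.2 hS)
    (Matrix.nonneg_iff_posSemidef.2 hT) h)

/-- With `C = A S⁻¹` a contraction and `D = B S⁻¹`, the Hermitian matrix `Y = S⁻¹ (Aᴴ B) S⁻¹` equals
both `Cᴴ D` and `Dᴴ C`. Hence `Y² = Dᴴ C Cᴴ D ≤ Dᴴ D ≤ (S⁻¹ T)²`. Monotonicity of the root gives `Y
≤ S⁻¹ T`, and conjugating by `S` gives the claim. -/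
theorem conjTranspose_mul_le_of_posDef {S T : Matrix n n ℂ} {A B : Matrix m n ℂ}
    (hS : S.PosDef) (hT : T.PosSemidef) (hST : Commute S T)
    (hA : (S * S - Aᴴ * A).PosSemidef) (hB : (T * T - Bᴴ * B).PosSemidef)
    (hX : (Aᴴ * B).IsHermitian) : (S * T - Aᴴ * B).PosSemidef := by
  have hu : IsUnit S.det := (Matrix.isUnit_iff_isUnit_det S).1 hS.isUnit
  have hSi : S⁻¹ * S = 1 := nonsing_inv_mul S hu
  have hSi' : S * S⁻¹ = 1 := mul_nonsing_inv S hu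
  have hSH : Sᴴ = S := hS.isHermitian.eq
  have hIH : (S⁻¹)ᴴ = S⁻¹ := hS.inv.isHermitian.eq
  have hIT : Commute S⁻¹ T := by
    have h1 : S⁻¹ * (S * T) * S⁻¹ = S⁻¹ * (T * S) * S⁻¹ := by rw [hST.eq]
    rw [← Matrix.mul_assoc, hSi, Matrix.one_mul, Matrix.mul_assoc, Matrix.mul_assoc, hSi',
      Matrix.mul_one] at h1
    exact h1.symm
  obtain ⟨C, hC, hCA, -⟩ := exists_contraction_mul hS.posSemidef hA
  have hCA' : A * S⁻¹ = C := by rw [hCA, Matrix.mul_assoc, hSi', Matrix.mul_one]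
  have hX' : Bᴴ * A = Aᴴ * B := by simpa [IsHermitian, conjTranspose_mul] using hX
  have key : (S⁻¹ * T - S⁻¹ * (Aᴴ * B) * S⁻¹).PosSemidef := by
    refine posSemidef_sub_of_sq ?_ (posSemidef_mul_of_commute hS.inv.posSemidef hT hIT) ?_
    · unfold IsHermitian
      rw [conjTranspose_mul, conjTranspose_mul, hIH, hX.eq]
      simp only [Matrix.mul_assoc]
    · have h1 := (PosSemidef.conjTranspose_mul_mul_same hC.conjTranspose (B * S⁻¹)).add
        (PosSemidef.conjTranspose_mul_mul_same hB S⁻¹)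
      have h2 : S⁻¹ * T * (S⁻¹ * T) = S⁻¹ * (T * T) * S⁻¹ := by
        conv_lhs => rhs; rw [hIT.eq]
        simp only [Matrix.mul_assoc]
      have h3 : S⁻¹ * (Aᴴ * B) * S⁻¹ * (S⁻¹ * (Aᴴ * B) * S⁻¹)
          = (B * S⁻¹)ᴴ * (C * Cᴴ) * (B * S⁻¹) := by
        nth_rw 1 [← hX']
        rw [← hCA']
        simp only [conjTranspose_mul, hIH, Matrix.mul_assoc]
      rw [h2, h3]
      convert h1 using 1
      rw [conjTranspose_conjTranspose, hIH]
      simp only [Matrix.mul_sub, Matrix.sub_mul, Matrix.mul_one, conjTranspose_mul, hIH,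
        Matrix.mul_assoc]
      abel
  have h := PosSemidef.conjTranspose_mul_mul_same key S
  convert h using 1
  rw [hSH, Matrix.mul_sub, Matrix.sub_mul, ← Matrix.mul_assoc, hSi', Matrix.one_mul, hST.eq,
    ← Matrix.mul_assoc, ← Matrix.mul_assoc, hSi', Matrix.one_mul, Matrix.mul_assoc _ _ S, hSi,
    Matrix.mul_one]

/-- The geometric mean `S T` of the commuting matrices `S²` and `T²` is maximal among the
Hermitian off-diagonal blocks. -/
theorem conjTranspose_mul_le_of_commute {S T : Matrix n n ℂ} {A B : Matrix m n ℂ}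
    (hS : S.PosSemidef) (hT : T.PosSemidef) (hST : Commute S T)
    (hA : (S * S - Aᴴ * A).PosSemidef) (hB : (T * T - Bᴴ * B).PosSemidef)
    (hX : (Aᴴ * B).IsHermitian) : (S * T - Aᴴ * B).PosSemidef := by
  have hH : (S * T - Aᴴ * B).IsHermitian :=
    (posSemidef_mul_of_commute hS hT hST).isHermitian.sub hX
  -- Replacing `R` by `R + ε` keeps the domination, because its square grows by `2 ε R + ε²`. It
  -- makes `S` invertible, and the general case follows as `ε → 0` in each quadratic form.
  have shift : ∀ {R : Matrix n n ℂ} (C : Matrix m n ℂ), R.PosSemidef →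
      (R * R - Cᴴ * C).PosSemidef → ∀ ε : ℝ, 0 < ε →
      ((R + (ε : ℂ) • 1) * (R + (ε : ℂ) • 1) - Cᴴ * C).PosSemidef := by
    intro R C hR hC ε hε
    have e : (R + (ε : ℂ) • 1) * (R + (ε : ℂ) • 1) - Cᴴ * C
        = (R * R - Cᴴ * C) + (((2 * ε : ℝ) : ℂ) • R + ((ε ^ 2 : ℝ) : ℂ) • 1) := by
      simp only [Matrix.add_mul, Matrix.mul_add, smul_mul_assoc, mul_smul_comm, Matrix.mul_one,
        Matrix.one_mul]
      push_cast
      module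
    rw [e]
    exact hC.add ((posSemidef_real_smul hR (by positivity)).add
      (posSemidef_real_smul PosSemidef.one (by positivity)))
  refine PosSemidef.of_dotProduct_mulVec_nonneg hH fun v => ?_
  have him := hH.im_star_dotProduct_mulVec_self v
  rw [Complex.le_def]
  refine ⟨?_, him.symm⟩
  rw [Complex.zero_re]
  set a := (star v ⬝ᵥ ((S * T - Aᴴ * B) *ᵥ v)).re with ha
  set b := (star v ⬝ᵥ ((S + T) *ᵥ v)).re with hb
  set c := (star v ⬝ᵥ v).re with hc
  have hall : ∀ ε : ℝ, 0 < ε → 0 ≤ a + ε * b + ε ^ 2 * c := by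
    intro ε hε
    have hSd : (S + (ε : ℂ) • 1).PosDef :=
      PosDef.posSemidef_add hS (PosDef.one.smul (by exact_mod_cast hε))
    have hTd : (T + (ε : ℂ) • 1).PosSemidef :=
      hT.add (posSemidef_real_smul PosSemidef.one hε.le)
    have hcom : Commute (S + (ε : ℂ) • 1) (T + (ε : ℂ) • 1) := by
      refine Commute.add_left (Commute.add_right hST ?_) (Commute.add_right ?_ ?_)
      · exact (Commute.one_right S).smul_right _
      · exact (Commute.one_left T).smul_left _
      · exact ((Commute.one_left (1 : Matrix n n ℂ)).smul_left _).smul_right _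
    have h1 := conjTranspose_mul_le_of_posDef hSd hTd hcom (shift A hS hA ε hε)
      (shift B hT hB ε hε) hX
    have e : (S + (ε : ℂ) • 1) * (T + (ε : ℂ) • 1) - Aᴴ * B
        = (S * T - Aᴴ * B) + (ε : ℂ) • (S + T) + ((ε ^ 2 : ℝ) : ℂ) • 1 := by
      simp only [Matrix.add_mul, Matrix.mul_add, smul_mul_assoc, mul_smul_comm, Matrix.mul_one,
        Matrix.one_mul]
      push_cast
      module
    rw [e] at h1
    have h2 := (Complex.le_def.1 (h1.dotProduct_mulVec_nonneg v)).1
    rw [add_mulVec, add_mulVec, smul_mulVec, smul_mulVec, one_mulVec, dotProduct_add,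
      dotProduct_add, dotProduct_smul, dotProduct_smul, smul_eq_mul, smul_eq_mul, Complex.add_re,
      Complex.add_re, Complex.re_ofReal_mul, Complex.re_ofReal_mul] at h2
    exact h2
  have hlim : Filter.Tendsto (fun ε : ℝ => a + ε * b + ε ^ 2 * c) (nhdsWithin 0 (Set.Ioi 0))
      (nhds a) := by
    have : Continuous fun ε : ℝ => a + ε * b + ε ^ 2 * c := by fun_prop
    have h := this.tendsto 0
    simp only [zero_mul, add_zero, ne_eq, OfNat.ofNat_ne_zero, not_false_eq_true, zero_pow] at h
    exact h.mono_left nhdsWithin_le_nhds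
  exact ge_of_tendsto hlim (Filter.eventually_of_mem self_mem_nhdsWithin fun ε hε => hall ε hε)

end Monotonicity

/-! ### Partial traces and regrouped purifications -/

section PartialTrace

variable {n x r : Type} [Fintype n] [DecidableEq n] [Fintype x] [DecidableEq x]
  [Fintype r] [DecidableEq r]

/-- The partial trace over the second factor. -/
def partialTrace (M : Matrix (n × x) (n × x) ℂ) : Matrix n n ℂ :=
  Matrix.of fun i j => ∑ k, M (i, k) (j, k)

theorem partialTrace_sub (M N : Matrix (n × x) (n × x) ℂ) :
    partialTrace (M - N) = partialTrace M - partialTrace N := by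
  ext i j
  simp [partialTrace, Finset.sum_sub_distrib]

theorem trace_partialTrace (M : Matrix (n × x) (n × x) ℂ) :
    (partialTrace M).trace = M.trace := by
  simp [partialTrace, trace, Fintype.sum_prod_type]

/-- The columns of the second factor, moved to the rows. -/
def foldRows (A : Matrix r (n × x) ℂ) : Matrix (r × x) n ℂ :=
  Matrix.of fun p j => A p.1 (j, p.2)

/-- Once the traced index is a row index, the Gram product sums over it. So a factor `A` with `Aᴴ *
A = ρ` folds to a factor of the partial trace of `ρ`, with overlaps between two factors preserved up
to partial trace. -/
theorem foldRows_conjTranspose_mul (A B : Matrix r (n × x) ℂ) :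
    (foldRows A)ᴴ * foldRows B = partialTrace (Aᴴ * B) := by
  ext i j
  simp only [foldRows, partialTrace, mul_apply, conjTranspose_apply, of_apply,
    Fintype.sum_prod_type]
  exact Finset.sum_comm

theorem posSemidef_partialTrace {M : Matrix (n × x) (n × x) ℂ} (hM : M.PosSemidef) :
    (partialTrace M).PosSemidef := by
  have h : partialTrace M = (foldRows (msqrt M))ᴴ * foldRows (msqrt M) := by
    rw [foldRows_conjTranspose_mul, (posSemidef_msqrt M).isHermitian.eq, msqrt_mul_self hM]
  rw [h]
  exact posSemidef_conjTranspose_mul_self _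

theorem isState_partialTrace {M : Matrix (n × x) (n × x) ℂ} (hM : IsState M) :
    IsState (partialTrace M) :=
  ⟨posSemidef_partialTrace hM.1, by rw [trace_partialTrace, hM.2]⟩

theorem partialTrace_blockDiagonal (M : x → Matrix n n ℂ) :
    partialTrace (blockDiagonal M) = ∑ i, M i := by
  ext i j
  simp [partialTrace, blockDiagonal_apply, Matrix.sum_apply]

end PartialTrace

/-- A measure of similarity of states that is multiplicative and additive in the appropriate sense
and cannot decrease when a subsystem is discarded. -/
structure IsSimilarity
    (f : ∀ (n : Type) [Fintype n] [DecidableEq n], Matrix n n ℂ → Matrix n n ℂ → ℝ) : Prop where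
  le_one : ∀ {n : Type} [Fintype n] [DecidableEq n] {ρ σ : Matrix n n ℂ},
    IsState ρ → IsState σ → f n ρ σ ≤ 1
  eq_one_iff : ∀ {n : Type} [Fintype n] [DecidableEq n] {ρ σ : Matrix n n ℂ},
    IsState ρ → IsState σ → (f n ρ σ = 1 ↔ σ = ρ)
  partialTrace_le : ∀ {n x : Type} [Fintype n] [DecidableEq n] [Fintype x] [DecidableEq x]
    {ρ σ : Matrix (n × x) (n × x) ℂ}, ρ.PosSemidef → σ.PosSemidef →
    f (n × x) ρ σ ≤ f n (partialTrace ρ) (partialTrace σ)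
  blockDiagonal : ∀ {n x : Type} [Fintype n] [DecidableEq n] [Fintype x] [DecidableEq x]
    {ρ σ : x → Matrix n n ℂ}, (∀ i, (ρ i).PosSemidef) → (∀ i, (σ i).PosSemidef) →
    f (n × x) (Matrix.blockDiagonal ρ) (Matrix.blockDiagonal σ) = ∑ i, f n (ρ i) (σ i)
  smul : ∀ {n : Type} [Fintype n] [DecidableEq n] {ρ σ : Matrix n n ℂ} {c : ℝ},
    ρ.PosSemidef → σ.PosSemidef → 0 ≤ c → f n ((c : ℂ) • ρ) ((c : ℂ) • σ) = c * f n ρ σ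
  kronecker : ∀ {n x : Type} [Fintype n] [DecidableEq n] [Fintype x] [DecidableEq x]
    {ρ σ : Matrix n n ℂ} {τ : Matrix x x ℂ}, ρ.PosSemidef → σ.PosSemidef → IsState τ →
    f (n × x) (ρ ⊗ₖ τ) (σ ⊗ₖ τ) = f n ρ σ
  submatrix : ∀ {n m : Type} [Fintype n] [DecidableEq n] [Fintype m] [DecidableEq m]
    {ρ σ : Matrix n n ℂ} (e : m ≃ n), ρ.PosSemidef → σ.PosSemidef →
    f m (ρ.submatrix e e) (σ.submatrix e e) = f n ρ σ
  inv_sqrt_le : ∀ {n : Type} [Fintype n] [DecidableEq n] {ρ σ : Matrix n n ℂ} {d : ℝ},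
    IsState ρ → IsState σ → 0 < d → ((d : ℂ) • σ - ρ).PosSemidef → 1 / Real.sqrt d ≤ f n ρ σ
  eq_inv_sqrt : ∀ {n : Type} [Fintype n] [DecidableEq n] {ρ σ : Matrix n n ℂ} {d : ℝ},
    IsState ρ → IsState σ → 0 < d → ρ * ρ = ρ → (d : ℂ) • (σ * σ) = σ →
    (d : ℂ) • (σ * ρ) = ρ → f n ρ σ = 1 / Real.sqrt d

theorem trace_submatrix_equiv {n m : Type} [Fintype n] [Fintype m] (M : Matrix n n ℂ)
    (e : m ≃ n) : (M.submatrix e e).trace = M.trace :=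
  e.sum_comp fun i => M i i

/-! ### The affinity and its monotonicity -/

section Affinity

variable {n x : Type} [Fintype n] [DecidableEq n] [Fintype x] [DecidableEq x]

/-- `Tr √ρ √σ`. -/
def affinity (n : Type) [Fintype n] [DecidableEq n] (ρ σ : Matrix n n ℂ) : ℝ :=
  (msqrt ρ * msqrt σ).trace.re

/-- This identity links the affinity to the squared Hellinger distance, and its left side being a
Hilbert–Schmidt norm squared settles the bound by one and the equality case. -/
theorem re_trace_sub_sq {ρ σ : Matrix n n ℂ} (hρ : IsState ρ) (hσ : IsState σ) :
    ((msqrt σ - msqrt ρ)ᴴ * (msqrt σ - msqrt ρ)).trace.re = 2 - 2 * affinity n ρ σ := by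
  rw [conjTranspose_sub, (posSemidef_msqrt ρ).isHermitian.eq,
    (posSemidef_msqrt σ).isHermitian.eq, Matrix.mul_sub, Matrix.sub_mul, Matrix.sub_mul,
    msqrt_mul_self hρ.1, msqrt_mul_self hσ.1, trace_sub, trace_sub, trace_sub, hρ.2, hσ.2,
    trace_mul_comm (msqrt σ) (msqrt ρ), affinity]
  simp only [Complex.sub_re, Complex.one_re]
  ring

theorem affinity_le_one {ρ σ : Matrix n n ℂ} (hρ : IsState ρ) (hσ : IsState σ) :
    affinity n ρ σ ≤ 1 := by
  have h := (Complex.le_def.1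
    (posSemidef_conjTranspose_mul_self (msqrt σ - msqrt ρ)).trace_nonneg).1
  rw [re_trace_sub_sq hρ hσ, Complex.zero_re] at h
  linarith

theorem trace_im_eq_zero {M : Matrix n n ℂ} (hM : M.PosSemidef) : M.trace.im = 0 :=
  (Complex.le_def.1 hM.trace_nonneg).2.symm

theorem affinity_eq_one_iff {ρ σ : Matrix n n ℂ} (hρ : IsState ρ) (hσ : IsState σ) :
    affinity n ρ σ = 1 ↔ σ = ρ := by
  have h := re_trace_sub_sq hρ hσ
  constructor
  · intro h1
    have h2 : ((msqrt σ - msqrt ρ)ᴴ * (msqrt σ - msqrt ρ)).trace = 0 :=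
      Complex.ext (by rw [h, h1]; norm_num)
        (trace_im_eq_zero (posSemidef_conjTranspose_mul_self _))
    rw [trace_conjTranspose_mul_self_eq_zero_iff, sub_eq_zero] at h2
    rw [← msqrt_mul_self hρ.1, ← msqrt_mul_self hσ.1, h2]
  · rintro rfl
    rw [affinity, msqrt_mul_self hρ.1, hρ.2, Complex.one_re]

/-- `⟨w, M w⟩` for `w = ∑ᵢ |i⟩|i⟩`. -/
theorem dotProduct_diag_mulVec (M : Matrix (n × n) (n × n) ℂ) :
    (star fun p : n × n => if p.1 = p.2 then (1 : ℂ) else 0) ⬝ᵥ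
      (M *ᵥ fun p : n × n => if p.1 = p.2 then (1 : ℂ) else 0) = ∑ i, ∑ j, M (i, i) (j, j) := by
  simp [dotProduct, mulVec, Fintype.sum_prod_type, apply_ite (star : ℂ → ℂ)]

theorem affinity_partialTrace_le {ρ σ : Matrix (n × x) (n × x) ℂ} (hρ : ρ.PosSemidef)
    (hσ : σ.PosSemidef) :
    affinity (n × x) ρ σ ≤ affinity n (partialTrace ρ) (partialTrace σ) := by
  have hr : ∀ i j, star (msqrt ρ i j) = msqrt ρ j i := fun i j =>
    (posSemidef_msqrt ρ).isHermitian.apply j i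
  have hs : ∀ i j, star (msqrt σ i j) = msqrt σ j i := fun i j =>
    (posSemidef_msqrt σ).isHermitian.apply j i
  -- Let `W` insert the vector `∑ₖ |k⟩|k⟩` on the two copies of `x`. Then `A = (√ρ ⊗ 1) W` and `B =
  -- (1 ⊗ √σᵀ) W`, so `Aᴴ * A` and `Bᴴ * B` are the two partial traces placed on different factors,
  -- which therefore commute, and `Aᴴ * B` is the compression of `√ρ ⊗ √σᵀ` by `W`. The transpose
  -- makes the diagonal vector turn tensor products into traces.
  set A : Matrix ((n × x) × (n × x)) (n × n) ℂ := Matrix.of fun p q =>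
    if q.2 = p.2.1 then msqrt ρ p.1 (q.1, p.2.2) else 0 with hA
  set B : Matrix ((n × x) × (n × x)) (n × n) ℂ := Matrix.of fun p q =>
    if q.1 = p.1.1 then msqrt σ (q.2, p.1.2) p.2 else 0 with hB
  set S : Matrix (n × n) (n × n) ℂ := msqrt (partialTrace ρ) ⊗ₖ (1 : Matrix n n ℂ) with hS
  set T : Matrix (n × n) (n × n) ℂ := (1 : Matrix n n ℂ) ⊗ₖ (msqrt (partialTrace σ))ᵀ with hT
  have hSS : S * S = partialTrace ρ ⊗ₖ (1 : Matrix n n ℂ) := by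
    rw [hS, ← mul_kronecker_mul, msqrt_mul_self (posSemidef_partialTrace hρ), Matrix.mul_one]
  have hTT : T * T = (1 : Matrix n n ℂ) ⊗ₖ (partialTrace σ)ᵀ := by
    rw [hT, ← mul_kronecker_mul, ← transpose_mul, msqrt_mul_self (posSemidef_partialTrace hσ),
      Matrix.mul_one]
  have hAA : Aᴴ * A = S * S := by
    rw [hSS]
    ext ⟨m, o⟩ ⟨m', o'⟩
    have h1 : partialTrace ρ m m' = ∑ l, ∑ i, msqrt ρ (m, l) i * msqrt ρ i (m', l) := by
      simp only [partialTrace, of_apply, ← mul_apply, msqrt_mul_self hρ]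
    rw [kronecker_apply, h1, one_apply, mul_apply, Fintype.sum_prod_type_right,
      Fintype.sum_prod_type]
    simp only [hA, conjTranspose_apply, of_apply, apply_ite star, star_zero, hr, ite_mul, mul_ite,
      zero_mul, mul_zero, mul_one, Finset.sum_ite_irrel, Finset.sum_const_zero,
      Finset.sum_ite_eq, Finset.mem_univ, if_true]
  have hBB : Bᴴ * B = T * T := by
    rw [hTT]
    ext ⟨m, o⟩ ⟨m', o'⟩
    have h1 : partialTrace σ o' o = ∑ k, ∑ j, msqrt σ (o', k) j * msqrt σ j (o, k) := by
      simp only [partialTrace, of_apply, ← mul_apply, msqrt_mul_self hσ]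
    rw [kronecker_apply, transpose_apply, h1, one_apply, mul_apply, Fintype.sum_prod_type,
      Fintype.sum_prod_type]
    simp only [hB, conjTranspose_apply, of_apply, apply_ite star, star_zero, hs, ite_mul, mul_ite,
      zero_mul, mul_zero, one_mul, Finset.sum_ite_irrel, Finset.sum_const_zero, mul_comm]
    split_ifs <;> simp_all
  have hAB : ∀ m o m' o', (Aᴴ * B) (m, o) (m', o')
      = ∑ k, ∑ l, msqrt ρ (m, l) (m', k) * msqrt σ (o', k) (o, l) := by
    intro m o m' o'
    rw [mul_apply, Fintype.sum_prod_type, Fintype.sum_prod_type]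
    simp only [Fintype.sum_prod_type, hA, hB, conjTranspose_apply, of_apply, apply_ite star,
      star_zero, hr, ite_mul, mul_ite, zero_mul, mul_zero, Finset.sum_ite_irrel,
      Finset.sum_const_zero, Finset.sum_ite_eq, Finset.mem_univ, if_true]
  have hX : (Aᴴ * B).IsHermitian := by
    ext ⟨m, o⟩ ⟨m', o'⟩
    rw [conjTranspose_apply, hAB, hAB, Finset.sum_comm, star_sum]
    refine Finset.sum_congr rfl fun k _ => ?_
    simp only [star_sum, star_mul', hr, hs]
  have h := conjTranspose_mul_le_of_commute (A := A) (B := B)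
    ((posSemidef_msqrt (partialTrace ρ)).kronecker PosSemidef.one)
    (PosSemidef.one.kronecker (posSemidef_msqrt (partialTrace σ)).transpose)
    (by
      rw [Commute, SemiconjBy, ← mul_kronecker_mul, ← mul_kronecker_mul]
      simp only [Matrix.mul_one, Matrix.one_mul])
    (by rw [← hS, hAA, sub_self]; exact PosSemidef.zero)
    (by rw [← hT, hBB, sub_self]; exact PosSemidef.zero) hX
  -- At `w = ∑ᵢ |i⟩|i⟩`, the form of `M ⊗ Nᵀ` is `Tr (M N)`, and `W w` is the corresponding vector
  -- of the large space. The operator inequality thus becomes the inequality of affinities.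
  have h1 := (Complex.le_def.1 (h.dotProduct_mulVec_nonneg
    (fun p : n × n => if p.1 = p.2 then (1 : ℂ) else 0))).1
  rw [dotProduct_diag_mulVec, ← mul_kronecker_mul, Matrix.mul_one, Matrix.one_mul] at h1
  have e1 : ∑ i, ∑ j, (msqrt (partialTrace ρ) ⊗ₖ (msqrt (partialTrace σ))ᵀ) (i, i) (j, j)
      = (msqrt (partialTrace ρ) * msqrt (partialTrace σ)).trace := by
    simp [trace, mul_apply]
  have e2 : ∑ i, ∑ j, (Aᴴ * B) (i, i) (j, j) = (msqrt ρ * msqrt σ).trace := by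
    simp only [hAB, trace, diag_apply, mul_apply, Fintype.sum_prod_type]
    refine Finset.sum_congr rfl fun i _ => ?_
    rw [Finset.sum_comm (γ := x)]
    exact Finset.sum_congr rfl fun j _ => Finset.sum_comm
  simp only [Matrix.sub_apply, Finset.sum_sub_distrib] at h1
  rw [e1, e2, Complex.sub_re, Complex.zero_re, sub_nonneg] at h1
  exact h1

theorem isSimilarity_affinity : IsSimilarity affinity where
  le_one := affinity_le_one
  eq_one_iff := affinity_eq_one_iff
  partialTrace_le := affinity_partialTrace_le
  blockDiagonal {n x} _ _ _ _ {ρ σ} hρ hσ := by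
    rw [affinity, msqrt_blockDiagonal hρ, msqrt_blockDiagonal hσ, ← blockDiagonal_mul,
      trace_blockDiagonal, Complex.re_sum]
    rfl
  smul {n} _ _ {ρ σ c} hρ hσ hc := by
    rw [affinity, msqrt_smul hρ hc, msqrt_smul hσ hc, smul_mul_smul_comm, trace_smul,
      ← Complex.ofReal_mul, Real.mul_self_sqrt hc, smul_eq_mul, Complex.re_ofReal_mul]
    rfl
  kronecker {n x} _ _ _ _ {ρ σ τ} hρ hσ hτ := by
    rw [affinity, msqrt_kronecker hρ hτ.1, msqrt_kronecker hσ hτ.1, ← mul_kronecker_mul,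
      msqrt_mul_self hτ.1, trace_kronecker, hτ.2, mul_one]
    rfl
  submatrix {n m} _ _ _ _ {ρ σ} e hρ hσ := by
    rw [affinity, msqrt_submatrix hρ, msqrt_submatrix hσ, submatrix_mul_equiv,
      trace_submatrix_equiv]
    rfl
  inv_sqrt_le {n} _ _ {ρ σ d} hρ hσ hd h := by
    have h1 := msqrt_mono hρ.1 (posSemidef_real_smul hσ.1 hd.le) h
    rw [msqrt_smul hσ.1 hd.le] at h1
    -- Conjugating `√ρ ≤ √d √σ` by the fourth root of `ρ` and taking traces gives `1 = Tr ρ ≤ √d Tr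
    -- √ρ √σ`.
    have h2 := (Complex.le_def.1 (PosSemidef.conjTranspose_mul_mul_same h1
      (msqrt (msqrt ρ))).trace_nonneg).1
    rw [Matrix.mul_assoc, trace_mul_comm, (posSemidef_msqrt (msqrt ρ)).isHermitian.eq,
      Matrix.mul_assoc, msqrt_mul_self (posSemidef_msqrt ρ), Matrix.sub_mul,
      msqrt_mul_self hρ.1, smul_mul_assoc, trace_sub, hρ.2, trace_smul, trace_mul_comm,
      smul_eq_mul, Complex.sub_re, Complex.re_ofReal_mul, Complex.zero_re, Complex.one_re] at h2
    rw [div_le_iff₀ (Real.sqrt_pos.2 hd), affinity, mul_comm]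
    linarith
  eq_inv_sqrt {n} _ _ {ρ σ d} hρ hσ hd h1 h2 h3 := by
    -- The hypotheses make `ρ` and `d σ` projections, so both roots are explicit and only `Tr σ ρ =
    -- 1 / d` is needed.
    have e1 : msqrt ρ = ρ := msqrt_eq hρ.1 h1
    have e2 : msqrt σ = (Real.sqrt d : ℂ) • σ := by
      refine msqrt_eq (posSemidef_real_smul hσ.1 (Real.sqrt_nonneg d)) ?_
      rw [smul_mul_smul_comm, ← Complex.ofReal_mul, Real.mul_self_sqrt hd.le, h2]
    have h4 : (σ * ρ).trace.re = 1 / d := by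
      have h5 : ((d : ℂ) • (σ * ρ)).trace = 1 := by rw [h3, hρ.2]
      rw [trace_smul, smul_eq_mul] at h5
      have h6 := congrArg Complex.re h5
      rw [Complex.re_ofReal_mul, Complex.one_re] at h6
      rw [eq_div_iff hd.ne', mul_comm, h6]
    rw [affinity, e1, e2, trace_mul_comm, smul_mul_assoc, trace_smul, smul_eq_mul,
      Complex.re_ofReal_mul, h4, mul_one_div, Real.sqrt_div_self']

end Affinity

/-! ### The root fidelity and Uhlmann's theorem -/

section Fidelity

variable {n x r : Type} [Fintype n] [DecidableEq n] [Fintype x] [DecidableEq x]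
  [Fintype r] [DecidableEq r]

/-- `‖√σ √ρ‖₁`, the square root of the fidelity. -/
def rootFidelity (n : Type) [Fintype n] [DecidableEq n] (ρ σ : Matrix n n ℂ) : ℝ :=
  (mabs (msqrt σ * msqrt ρ)).trace.re

/-- One half of Uhlmann's theorem. -/
theorem re_trace_le_rootFidelity {A B : Matrix r n ℂ} {ρ σ : Matrix n n ℂ} (hρ : ρ.PosSemidef)
    (hσ : σ.PosSemidef) (hA : (ρ - Aᴴ * A).PosSemidef) (hB : (σ - Bᴴ * B).PosSemidef) :
    (Aᴴ * B).trace.re ≤ rootFidelity n ρ σ := by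
  -- Sub-purifications, with `Aᴴ * A ≤ ρ` only, suffice: `A = V √ρ` and `B = W √σ` have overlap `Tr
  -- (Vᴴ W √σ √ρ)`, and `Vᴴ W` is a contraction.
  obtain ⟨V, hV, rfl, -⟩ := exists_contraction_mul (posSemidef_msqrt ρ)
    (by rwa [msqrt_mul_self hρ])
  obtain ⟨W, hW, rfl, -⟩ := exists_contraction_mul (posSemidef_msqrt σ)
    (by rwa [msqrt_mul_self hσ])
  have h := re_trace_contraction_mul_le_mabs (M := msqrt σ * msqrt ρ) (hV.conjTranspose.mul hW)
  refine le_of_eq_of_le (congrArg Complex.re ?_) h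
  rw [conjTranspose_mul, (posSemidef_msqrt ρ).isHermitian.eq, Matrix.mul_assoc, trace_mul_comm]
  simp only [Matrix.mul_assoc]

/-- The other half: the fidelity is the overlap of two purifications. -/
theorem exists_re_trace_eq_rootFidelity (ρ : Matrix n n ℂ) {σ : Matrix n n ℂ}
    (hσ : σ.PosSemidef) :
    ∃ B : Matrix n n ℂ, (σ - Bᴴ * B).PosSemidef ∧
      (msqrt ρ * B).trace.re = rootFidelity n ρ σ := by
  obtain ⟨K, hK, h⟩ := exists_contraction_trace_eq (msqrt σ * msqrt ρ)
  refine ⟨K * msqrt σ, ?_, ?_⟩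
  · have h1 := PosSemidef.conjTranspose_mul_mul_same hK (msqrt σ)
    convert h1 using 1
    rw [Matrix.mul_sub, Matrix.sub_mul, Matrix.mul_one, (posSemidef_msqrt σ).isHermitian.eq,
      msqrt_mul_self hσ, conjTranspose_mul, (posSemidef_msqrt σ).isHermitian.eq]
    simp only [Matrix.mul_assoc]
  · rw [rootFidelity, h, trace_mul_comm, Matrix.mul_assoc]

theorem affinity_le_rootFidelity (ρ σ : Matrix n n ℂ) :
    affinity n ρ σ ≤ rootFidelity n ρ σ := by
  have h := re_trace_contraction_mul_le_mabs (M := msqrt σ * msqrt ρ) isContraction_one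
  rwa [Matrix.one_mul, trace_mul_comm] at h

theorem rootFidelity_nonneg (ρ σ : Matrix n n ℂ) : 0 ≤ rootFidelity n ρ σ :=
  (Complex.le_def.1 (posSemidef_mabs _).trace_nonneg).1

/-- Expanding the square leaves `1 - 2 f + Tr (Bᴴ B)`, where `Tr (Bᴴ B) ≤ Tr σ = 1`. This is the
analogue for the fidelity of the identity for the affinity, and serves the same two ends. -/
theorem exists_purification_dist {ρ σ : Matrix n n ℂ} (hρ : IsState ρ) (hσ : IsState σ) :
    ∃ B : Matrix n n ℂ, (σ - Bᴴ * B).PosSemidef ∧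
      ((msqrt ρ - B)ᴴ * (msqrt ρ - B)).trace.re ≤ 2 - 2 * rootFidelity n ρ σ := by
  obtain ⟨B, hB, h⟩ := exists_re_trace_eq_rootFidelity ρ hσ.1
  refine ⟨B, hB, ?_⟩
  have h1 := (Complex.le_def.1 hB.trace_nonneg).1
  rw [trace_sub, hσ.2, Complex.sub_re, Complex.one_re, Complex.zero_re] at h1
  have h2 : (Bᴴ * msqrt ρ).trace.re = (msqrt ρ * B).trace.re := by
    have : Bᴴ * msqrt ρ = (msqrt ρ * B)ᴴ := by
      rw [conjTranspose_mul, (posSemidef_msqrt ρ).isHermitian.eq]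
    rw [this, trace_conjTranspose]
    rfl
  rw [conjTranspose_sub, (posSemidef_msqrt ρ).isHermitian.eq, Matrix.mul_sub, Matrix.sub_mul,
    Matrix.sub_mul, msqrt_mul_self hρ.1, trace_sub, trace_sub, trace_sub, hρ.2]
  simp only [Complex.sub_re, Complex.one_re, h2, h]
  linarith

theorem rootFidelity_le_one {ρ σ : Matrix n n ℂ} (hρ : IsState ρ) (hσ : IsState σ) :
    rootFidelity n ρ σ ≤ 1 := by
  obtain ⟨B, -, h⟩ := exists_purification_dist hρ hσ
  have h1 := (Complex.le_def.1
    (posSemidef_conjTranspose_mul_self (msqrt ρ - B)).trace_nonneg).1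
  rw [Complex.zero_re] at h1
  linarith

theorem rootFidelity_eq_one_iff {ρ σ : Matrix n n ℂ} (hρ : IsState ρ) (hσ : IsState σ) :
    rootFidelity n ρ σ = 1 ↔ σ = ρ := by
  constructor
  · intro h1
    obtain ⟨B, hB, h⟩ := exists_purification_dist hρ hσ
    have hp := posSemidef_conjTranspose_mul_self (msqrt ρ - B)
    have h2 : ((msqrt ρ - B)ᴴ * (msqrt ρ - B)).trace = 0 :=
      Complex.ext (le_antisymm (by rw [h1] at h; simpa using h)
        (Complex.le_def.1 hp.trace_nonneg).1) (trace_im_eq_zero hp)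
    -- Now `B = √ρ`, so `Bᴴ * B ≤ σ` reads `ρ ≤ σ`, and equal traces force equality.
    rw [trace_conjTranspose_mul_self_eq_zero_iff, sub_eq_zero] at h2
    rw [← h2, (posSemidef_msqrt ρ).isHermitian.eq, msqrt_mul_self hρ.1] at hB
    have h3 : (σ - ρ).trace = 0 := by rw [trace_sub, hσ.2, hρ.2, sub_self]
    exact sub_eq_zero.1 (hB.trace_eq_zero_iff.1 h3)
  · intro h
    refine le_antisymm (rootFidelity_le_one hρ hσ) ?_
    rw [← (affinity_eq_one_iff hρ hσ).2 h]
    exact affinity_le_rootFidelity ρ σ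

/-- Fold an optimal pair of purifications: the overlap is unchanged, and the folded pair competes in
Uhlmann's bound for the partial traces. -/
theorem rootFidelity_partialTrace_le {ρ σ : Matrix (n × x) (n × x) ℂ} (hρ : ρ.PosSemidef)
    (hσ : σ.PosSemidef) :
    rootFidelity (n × x) ρ σ ≤ rootFidelity n (partialTrace ρ) (partialTrace σ) := by
  obtain ⟨B, hB, h⟩ := exists_re_trace_eq_rootFidelity ρ hσ
  have h1 := re_trace_le_rootFidelity (A := foldRows (msqrt ρ)) (B := foldRows B)
    (posSemidef_partialTrace hρ) (posSemidef_partialTrace hσ)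
    (by
      rw [foldRows_conjTranspose_mul, (posSemidef_msqrt ρ).isHermitian.eq, msqrt_mul_self hρ,
        sub_self]
      exact PosSemidef.zero)
    (by
      rw [foldRows_conjTranspose_mul, ← partialTrace_sub]
      exact posSemidef_partialTrace hB)
  rwa [foldRows_conjTranspose_mul, trace_partialTrace, (posSemidef_msqrt ρ).isHermitian.eq,
    h] at h1

theorem isSimilarity_rootFidelity : IsSimilarity rootFidelity where
  le_one := rootFidelity_le_one
  eq_one_iff := rootFidelity_eq_one_iff
  partialTrace_le := rootFidelity_partialTrace_le
  blockDiagonal {n x} _ _ _ _ {ρ σ} hρ hσ := by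
    rw [rootFidelity, msqrt_blockDiagonal hρ, msqrt_blockDiagonal hσ, ← blockDiagonal_mul,
      mabs_blockDiagonal, trace_blockDiagonal, Complex.re_sum]
    rfl
  smul {n} _ _ {ρ σ c} hρ hσ hc := by
    rw [rootFidelity, msqrt_smul hρ hc, msqrt_smul hσ hc, smul_mul_smul_comm,
      ← Complex.ofReal_mul, Real.mul_self_sqrt hc, mabs_smul _ hc, trace_smul, smul_eq_mul,
      Complex.re_ofReal_mul]
    rfl
  kronecker {n x} _ _ _ _ {ρ σ τ} hρ hσ hτ := by
    rw [rootFidelity, msqrt_kronecker hρ hτ.1, msqrt_kronecker hσ hτ.1, ← mul_kronecker_mul,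
      msqrt_mul_self hτ.1, mabs_kronecker, mabs_eq_self hτ.1, trace_kronecker, hτ.2, mul_one]
    rfl
  submatrix {n m} _ _ _ _ {ρ σ} e hρ hσ := by
    rw [rootFidelity, msqrt_submatrix hρ, msqrt_submatrix hσ, submatrix_mul_equiv,
      mabs_submatrix, trace_submatrix_equiv]
    rfl
  inv_sqrt_le hρ hσ hd h :=
    (isSimilarity_affinity.inv_sqrt_le hρ hσ hd h).trans (affinity_le_rootFidelity _ _)
  eq_inv_sqrt {n} _ _ {ρ σ d} hρ hσ hd h1 h2 h3 := by
    have e1 : msqrt ρ = ρ := msqrt_eq hρ.1 h1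
    have e2 : msqrt σ = (Real.sqrt d : ℂ) • σ := by
      refine msqrt_eq (posSemidef_real_smul hσ.1 (Real.sqrt_nonneg d)) ?_
      rw [smul_mul_smul_comm, ← Complex.ofReal_mul, Real.mul_self_sqrt hd.le, h2]
    -- Here `√σ √ρ = √d σ ρ = ρ / √d` is already positive, so it is its own modulus.
    have e3 : msqrt σ * msqrt ρ = ((1 / Real.sqrt d : ℝ) : ℂ) • ρ := by
      rw [e1, e2, smul_mul_assoc]
      conv_rhs => rw [← h3]
      rw [smul_smul, ← Complex.ofReal_mul, one_div_mul_eq_div, Real.div_sqrt]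
    rw [rootFidelity, e3, mabs_eq_self (posSemidef_real_smul hρ.1 (by positivity)), trace_smul,
      hρ.2, smul_eq_mul, Complex.re_ofReal_mul, Complex.one_re, mul_one]

end Fidelity

/-! ### Projective measurements and their commutants -/

section Measurement

variable {a b c x : Type} [Fintype a] [DecidableEq a] [Fintype b] [DecidableEq b]
  [Fintype c] [DecidableEq c] [Fintype x] [DecidableEq x]

theorem basis_conjTranspose_mul (A : Observable a) :
    (A.basis : Matrix a a ℂ)ᴴ * (A.basis : Matrix a a ℂ) = 1 :=
  Matrix.mem_unitaryGroup_iff'.1 A.basis.2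

theorem basis_mul_conjTranspose (A : Observable a) :
    (A.basis : Matrix a a ℂ) * (A.basis : Matrix a a ℂ)ᴴ = 1 :=
  Matrix.mem_unitaryGroup_iff.1 A.basis.2

theorem proj_eq (A : Observable a) (k : a) :
    A.proj k = (A.basis : Matrix a a ℂ) * Matrix.single k k 1 * (A.basis : Matrix a a ℂ)ᴴ := by
  ext i j
  simp [Observable.proj, mul_apply, Matrix.single_apply, ite_and]

theorem proj_conjTranspose (A : Observable a) (k : a) : (A.proj k)ᴴ = A.proj k := by
  ext i j
  simp [Observable.proj, mul_comm]

theorem proj_mul_proj (A : Observable a) (k l : a) :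
    A.proj k * A.proj l = if k = l then A.proj k else 0 := by
  have h : A.proj k * A.proj l = (A.basis : Matrix a a ℂ) *
      (Matrix.single k k 1 * ((A.basis : Matrix a a ℂ)ᴴ * (A.basis : Matrix a a ℂ)) *
        Matrix.single l l 1) * (A.basis : Matrix a a ℂ)ᴴ := by
    simp only [proj_eq, Matrix.mul_assoc]
  rw [h, basis_conjTranspose_mul, Matrix.mul_one]
  split_ifs with hkl
  · subst hkl
    rw [single_mul_single_same, mul_one, proj_eq]
  · rw [single_mul_single_of_ne _ _ _ _ hkl, Matrix.mul_zero, Matrix.zero_mul]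

theorem proj_mul_self (A : Observable a) (k : a) : A.proj k * A.proj k = A.proj k := by
  rw [proj_mul_proj, if_pos rfl]

theorem sum_proj (A : Observable a) : ∑ k, A.proj k = 1 := by
  simp only [proj_eq, ← Finset.mul_sum, ← Finset.sum_mul]
  have h : ∑ k : a, Matrix.single k k (1 : ℂ) = 1 := by
    ext i j
    simp [Matrix.sum_apply, Matrix.single_apply, one_apply, ite_and]
  rw [h, Matrix.mul_one, basis_mul_conjTranspose]

theorem trace_proj_mul_proj (A : Observable a) (k l : a) :
    (A.proj k * A.proj l).trace = if k = l then 1 else 0 := by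
  rw [proj_mul_proj]
  split_ifs
  · rw [proj_eq, Matrix.mul_assoc, trace_mul_comm, Matrix.mul_assoc, basis_conjTranspose_mul]
    simp
  · simp

/-- The operator on `H_A` at a pair of basis vectors of `H_B`. -/
def slice (ρ : Matrix (a × b) (a × b) ℂ) (i j : b) : Matrix a a ℂ :=
  Matrix.of fun k l => ρ (k, i) (l, j)

theorem slice_ext {ρ σ : Matrix (a × b) (a × b) ℂ} (h : ∀ i j, slice ρ i j = slice σ i j) :
    ρ = σ := by
  ext ⟨k, i⟩ ⟨l, j⟩
  exact congrFun (congrFun (h i j) k) l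

/-- The measurement without a bystander. -/
def pinch (A : Observable a) (M : Matrix a a ℂ) : Matrix a a ℂ :=
  ∑ k, A.proj k * M * A.proj k

theorem pinch_smul (A : Observable a) (c : ℂ) (M : Matrix a a ℂ) :
    pinch A (c • M) = c • pinch A M := by
  simp [pinch, Finset.smul_sum]

theorem pinch_sum (A : Observable a) {ι : Type} (s : Finset ι) (M : ι → Matrix a a ℂ) :
    pinch A (∑ i ∈ s, M i) = ∑ i ∈ s, pinch A (M i) := by
  simp only [pinch, Finset.mul_sum, Finset.sum_mul]
  exact Finset.sum_comm

theorem pinch_one (A : Observable a) : pinch A 1 = 1 := by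
  simp only [pinch, Matrix.mul_one, proj_mul_self, sum_proj]

/-- The measurement acts on each `H_A`-block separately. Since `pinch` is linear, it commutes with
every operation on the bystander that takes linear combinations of blocks: discarding, adjoining,
reindexing. -/
theorem slice_measure (A : Observable a) (ρ : Matrix (a × b) (a × b) ℂ) (i j : b) :
    slice (measure A ρ) i j = pinch A (slice ρ i j) := by
  ext k l
  simp only [slice, measure, pinch, of_apply, Matrix.sum_apply]
  refine Finset.sum_congr rfl fun p _ => ?_
  simp [mul_apply, Fintype.sum_prod_type, one_apply]

theorem measure_smul (A : Observable a) (c : ℂ) (ρ : Matrix (a × b) (a × b) ℂ) :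
    measure A (c • ρ) = c • measure A ρ := by
  simp [measure, Finset.smul_sum]

theorem measure_sum (A : Observable a) {ι : Type} (s : Finset ι)
    (ρ : ι → Matrix (a × b) (a × b) ℂ) :
    measure A (∑ i ∈ s, ρ i) = ∑ i ∈ s, measure A (ρ i) := by
  simp only [measure, Finset.mul_sum, Finset.sum_mul]
  exact Finset.sum_comm

theorem pinch_pinch (A : Observable a) (M : Matrix a a ℂ) : pinch A (pinch A M) = pinch A M := by
  rw [pinch]
  refine Finset.sum_congr rfl fun k _ => ?_
  have h : ∀ l, A.proj k * (A.proj l * M * A.proj l) * A.proj k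
      = if k = l then A.proj k * M * A.proj k else 0 := by
    intro l
    have : A.proj k * (A.proj l * M * A.proj l) * A.proj k
        = (A.proj k * A.proj l) * M * (A.proj l * A.proj k) := by
      simp only [Matrix.mul_assoc]
    rw [this, proj_mul_proj, proj_mul_proj]
    split_ifs with h1 h2
    · subst h1; rfl
    · exact absurd h1.symm h2
    · simp
    · simp
  simp only [pinch, Finset.mul_sum, Finset.sum_mul, h, Finset.sum_ite_eq, Finset.mem_univ,
    if_true]

theorem measure_measure (A : Observable a) (ρ : Matrix (a × b) (a × b) ℂ) :
    measure A (measure A ρ) = measure A ρ :=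
  slice_ext fun i j => by rw [slice_measure, slice_measure, pinch_pinch]

theorem projB_conjTranspose (A : Observable a) (k : a) :
    (A.proj k ⊗ₖ (1 : Matrix b b ℂ))ᴴ = A.proj k ⊗ₖ (1 : Matrix b b ℂ) := by
  rw [conjTranspose_kronecker, proj_conjTranspose, conjTranspose_one]

theorem sum_projB (A : Observable a) :
    ∑ k, A.proj k ⊗ₖ (1 : Matrix b b ℂ) = 1 := by
  rw [← one_kronecker_one, ← sum_proj A]
  ext ⟨i, j⟩ ⟨k, l⟩
  simp [Matrix.sum_apply, Finset.sum_mul]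

theorem posSemidef_measure (A : Observable a) {ρ : Matrix (a × b) (a × b) ℂ}
    (hρ : ρ.PosSemidef) : (measure A ρ).PosSemidef := by
  refine posSemidef_sum _ fun k _ => ?_
  have h := hρ.conjTranspose_mul_mul_same (A.proj k ⊗ₖ (1 : Matrix b b ℂ))
  rwa [projB_conjTranspose] at h

theorem trace_measure (A : Observable a) (ρ : Matrix (a × b) (a × b) ℂ) :
    (measure A ρ).trace = ρ.trace := by
  have h : ∀ k, (A.proj k ⊗ₖ (1 : Matrix b b ℂ) * ρ * A.proj k ⊗ₖ (1 : Matrix b b ℂ)).trace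
      = (A.proj k ⊗ₖ (1 : Matrix b b ℂ) * ρ).trace := by
    intro k
    rw [trace_mul_comm, ← Matrix.mul_assoc, ← mul_kronecker_mul, proj_mul_self, Matrix.mul_one]
  rw [measure, trace_sum]
  simp only [h]
  rw [← trace_sum, ← Finset.sum_mul, sum_projB, Matrix.one_mul]

theorem isState_measure (A : Observable a) {ρ : Matrix (a × b) (a × b) ℂ} (hρ : IsState ρ) :
    IsState (measure A ρ) :=
  ⟨posSemidef_measure A hρ.1, by rw [trace_measure, hρ.2]⟩

/-- The pinching inequality. -/
theorem posSemidef_card_smul_measure_sub (A : Observable a) {ρ : Matrix (a × b) (a × b) ℂ}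
    (hρ : ρ.PosSemidef) :
    (((Fintype.card a : ℝ) : ℂ) • measure A ρ - ρ).PosSemidef := by
  set Q : a → Matrix (a × b) (a × b) ℂ := fun k => A.proj k ⊗ₖ (1 : Matrix b b ℂ) with hQ
  -- In the double sum over pairs, the two square terms contribute `2 d Φ_A(ρ)` and the two cross
  -- terms `-2 ρ`, because the projections sum to one.
  have h : ((Fintype.card a : ℝ) : ℂ) • measure A ρ - ρ
      = (((1 / 2 : ℝ)) : ℂ) • ∑ k, ∑ l, (Q k - Q l)ᴴ * ρ * (Q k - Q l) := by
    have h1 : ∀ k l, (Q k - Q l)ᴴ * ρ * (Q k - Q l)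
        = Q k * ρ * Q k + Q l * ρ * Q l - Q k * ρ * Q l - Q l * ρ * Q k := by
      intro k l
      rw [conjTranspose_sub, hQ, projB_conjTranspose, projB_conjTranspose]
      simp only [Matrix.sub_mul, Matrix.mul_sub]
      abel
    have h2 : ∑ k, ∑ l, Q k * ρ * Q l = ρ := by
      simp only [← Finset.mul_sum, ← Finset.sum_mul, hQ, sum_projB, Matrix.mul_one,
        Matrix.one_mul]
    have h3 : ∑ k, ∑ l, Q l * ρ * Q k = ρ := by rw [Finset.sum_comm, h2]
    have h4 : ∑ k, Q k * ρ * Q k = measure A ρ := rfl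
    simp only [h1, Finset.sum_sub_distrib, Finset.sum_add_distrib, h2, h3, Finset.sum_const,
      Finset.card_univ, ← Finset.smul_sum, h4]
    rw [← Nat.cast_smul_eq_nsmul ℂ]
    push_cast
    module
  rw [h]
  exact posSemidef_real_smul (posSemidef_sum _ fun k _ => posSemidef_sum _ fun l _ =>
    hρ.conjTranspose_mul_mul_same _) (by norm_num)

theorem measure_traceOut (A : Observable a) (ρ : Matrix (a × b × x) (a × b × x) ℂ) :
    measure A (traceOut ρ) = traceOut (measure A ρ) := by
  have h : ∀ (τ : Matrix (a × b × x) (a × b × x) ℂ) (i j : b),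
      slice (traceOut τ) i j = ∑ k, slice τ (i, k) (j, k) := by
    intro τ i j
    ext k l
    simp [slice, traceOut, Matrix.sum_apply]
  refine slice_ext fun i j => ?_
  simp only [slice_measure, h, pinch_sum]

theorem measure_adjoin (A : Observable a) (ρ : Matrix (a × b) (a × b) ℂ) (σ : Matrix c c ℂ) :
    measure A (adjoin ρ σ) = adjoin (measure A ρ) σ := by
  have h : ∀ (τ : Matrix (a × b) (a × b) ℂ) (i j : b × c),
      slice (adjoin τ σ) i j = σ i.2 j.2 • slice τ i.1 j.1 := by
    intro τ i j
    ext k l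
    simp [slice, adjoin, mul_comm]
  refine slice_ext fun i j => ?_
  simp only [slice_measure, h, pinch_smul]

theorem measure_submatrix (A : Observable a) (ρ : Matrix (a × b) (a × b) ℂ) (e : c ≃ b) :
    measure A (ρ.submatrix (Equiv.prodCongrRight fun _ => e) (Equiv.prodCongrRight fun _ => e))
      = (measure A ρ).submatrix (Equiv.prodCongrRight fun _ => e)
          (Equiv.prodCongrRight fun _ => e) := by
  have h : ∀ (τ : Matrix (a × b) (a × b) ℂ) (i j : c),
      slice (τ.submatrix (Equiv.prodCongrRight fun _ => e) (Equiv.prodCongrRight fun _ => e)) i j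
        = slice τ (e i) (e j) := fun τ i j => rfl
  refine slice_ext fun i j => ?_
  simp only [slice_measure, h]

theorem measure_of_isMixedOnA (A : Observable a) {ρ : Matrix (a × b) (a × b) ℂ}
    (h : IsMixedOnA ρ) : measure A ρ = ρ := by
  refine slice_ext fun i j => ?_
  have h1 : slice ρ i j = ((Fintype.card a : ℂ)⁻¹ * reducedB ρ i j) • (1 : Matrix a a ℂ) := by
    have h2 := congrArg (fun τ => slice τ i j) h
    rw [h2]
    ext k l
    simp [slice, one_apply, mul_comm]
  rw [slice_measure, h1, pinch_smul, pinch_one]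

/-- A pinched matrix has no off-diagonal blocks, so multiplication by an eigenprojection on either
side leaves the same diagonal block. -/
theorem commute_proj_of_pinch_eq {A : Observable a} {M : Matrix a a ℂ} (h : pinch A M = M)
    (k : a) : Commute (A.proj k) M := by
  have h1 : A.proj k * M = A.proj k * M * A.proj k := by
    conv_lhs => rw [← h, pinch, Finset.mul_sum]
    rw [Finset.sum_eq_single k]
    · simp only [← Matrix.mul_assoc, proj_mul_self]
    · intro l _ hl
      rw [← Matrix.mul_assoc, ← Matrix.mul_assoc, proj_mul_proj, if_neg (Ne.symm hl),
        Matrix.zero_mul, Matrix.zero_mul]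
    · simp
  have h2 : M * A.proj k = A.proj k * M * A.proj k := by
    conv_lhs => rw [← h, pinch, Finset.sum_mul]
    rw [Finset.sum_eq_single k]
    · rw [Matrix.mul_assoc, proj_mul_self]
    · intro l _ hl
      rw [Matrix.mul_assoc, proj_mul_proj, if_neg hl, Matrix.mul_zero]
    · simp
  exact h1.trans h2.symm

theorem commute_toMatrix {A : Observable a} {M : Matrix a a ℂ} (h : ∀ k, Commute (A.proj k) M) :
    Commute A.toMatrix M :=
  Commute.sum_left _ _ _ fun k _ => (h k).smul_left _

theorem proj_mul_toMatrix (A : Observable a) (k : a) :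
    A.proj k * A.toMatrix = (A.value k : ℂ) • A.proj k := by
  simp [Observable.toMatrix, Finset.mul_sum, proj_mul_proj]

theorem toMatrix_mul_proj (A : Observable a) (k : a) :
    A.toMatrix * A.proj k = (A.value k : ℂ) • A.proj k := by
  simp [Observable.toMatrix, Finset.sum_mul, proj_mul_proj]

theorem toMatrix_isHermitian (A : Observable a) : A.toMatrix.IsHermitian := by
  rw [IsHermitian, Observable.toMatrix, conjTranspose_sum]
  refine Finset.sum_congr rfl fun k _ => ?_
  rw [conjTranspose_smul, proj_conjTranspose]
  simp

/-- The spectrum of an observable is simple, so the eigenprojections belong to every commutant. -/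
theorem commute_proj_of_commute_toMatrix {A : Observable a} {M : Matrix a a ℂ}
    (h : Commute A.toMatrix M) (k : a) : Commute (A.proj k) M := by
  refine commute_proj_of_pinch_eq ?_ k
  -- Commutation multiplies the off-diagonal block by the difference of two eigenvalues, which is
  -- nonzero because the eigenvalues are distinct.
  have h0 : ∀ k l, k ≠ l → A.proj k * M * A.proj l = 0 := by
    intro k l hkl
    have h1 : A.proj k * (A.toMatrix * M) * A.proj l
        = A.proj k * (M * A.toMatrix) * A.proj l := by rw [h.eq]
    rw [← Matrix.mul_assoc (A.proj k), proj_mul_toMatrix] at h1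
    simp only [Matrix.mul_assoc, toMatrix_mul_proj, smul_mul_assoc, mul_smul_comm] at h1
    have h2 : ((A.value k : ℂ) - A.value l) • (A.proj k * M * A.proj l) = 0 := by
      rw [sub_smul, sub_eq_zero]
      simpa only [Matrix.mul_assoc] using h1
    refine (smul_eq_zero.1 h2).resolve_left ?_
    exact fun h3 => hkl (A.value_injective (by exact_mod_cast sub_eq_zero.1 h3))
  have h1 : ∑ k, ∑ l, A.proj k * M * A.proj l = M := by
    simp only [← Finset.mul_sum, ← Finset.sum_mul, sum_proj, Matrix.mul_one, Matrix.one_mul]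
  conv_rhs => rw [← h1]
  refine Finset.sum_congr rfl fun k _ => ?_
  rw [Finset.sum_eq_single k (fun l _ hl => h0 k l hl.symm) (by simp)]

theorem proj_mul_mul_proj (A : Observable a) (M : Matrix a a ℂ) (k : a) :
    ∃ c : ℂ, A.proj k * M * A.proj k = c • A.proj k := by
  refine ⟨((A.basis : Matrix a a ℂ)ᴴ * M * (A.basis : Matrix a a ℂ)) k k, ?_⟩
  have h : A.proj k * M * A.proj k = (A.basis : Matrix a a ℂ) * (Matrix.single k k 1 *
      ((A.basis : Matrix a a ℂ)ᴴ * M * (A.basis : Matrix a a ℂ)) * Matrix.single k k 1) *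
      (A.basis : Matrix a a ℂ)ᴴ := by
    simp only [proj_eq, Matrix.mul_assoc]
  rw [h, single_mul_mul_single, proj_eq]
  have h1 : ∀ z : ℂ, Matrix.single k k z = z • Matrix.single k k (1 : ℂ) := fun z => by simp
  rw [h1, Matrix.mul_smul, Matrix.smul_mul, one_mul, mul_one]

/-- In dimension two, non-commuting observables are irreducible. -/
theorem noCommonBlock_of_card_eq_two (hcard : Fintype.card a = 2) {X Y : Observable a}
    (hXY : ¬ Commute X.toMatrix Y.toMatrix) : NoCommonBlock X Y := by
  intro P _ hPP hPX hPY
  obtain ⟨k, l, hkl, huniv⟩ := Finset.card_eq_two.1 (Finset.card_univ.trans hcard)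
  have hsum : ∀ g : a → Matrix a a ℂ, ∑ i, g i = g k + g l := fun g => by
    rw [huniv, Finset.sum_pair hkl]
  -- Commuting with `X` makes `P = c X_k + c' X_l`. If `c = c'`, it is a scalar idempotent;
  -- otherwise `X_k` is affine in `P`, hence commutes with `Y`, and then so does `X`.
  have hP : P = X.proj k * P * X.proj k + X.proj l * P * X.proj l := by
    have h1 : ∀ i, X.proj i * P * X.proj i = X.proj i * P := fun i => by
      rw [Matrix.mul_assoc, ← (commute_proj_of_commute_toMatrix hPX.symm i).eq,
        ← Matrix.mul_assoc, proj_mul_self]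
    rw [h1, h1, ← Matrix.add_mul, ← hsum, sum_proj, Matrix.one_mul]
  obtain ⟨c, hc⟩ := proj_mul_mul_proj X P k
  obtain ⟨c', hc'⟩ := proj_mul_mul_proj X P l
  rw [hc, hc'] at hP
  have h1 : X.proj k + X.proj l = 1 := by rw [← hsum, sum_proj]
  have hl : X.proj l = 1 - X.proj k := by rw [← h1]; abel
  by_cases hcc : c = c'
  · rw [← hcc, ← smul_add, h1] at hP
    rw [hP, smul_mul_smul_comm, Matrix.mul_one] at hPP
    have h2 : (c * c - c) • (1 : Matrix a a ℂ) = 0 := by rw [sub_smul, hPP, sub_self]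
    rcases smul_eq_zero.1 h2 with h3 | h3
    · have h4 : c * (c - 1) = 0 := by rw [← h3]; ring
      rcases mul_eq_zero.1 h4 with h5 | h5
      · left; rw [hP, h5, zero_smul]
      · right; rw [hP, sub_eq_zero.1 h5, one_smul]
    · left; rw [hP, h3, smul_zero]
  · exfalso
    have h2 : X.proj k = (c - c')⁻¹ • (P - c' • 1) := by
      have h3 : P - c' • 1 = (c - c') • X.proj k := by rw [hP, hl]; module
      rw [h3, smul_smul, inv_mul_cancel₀ (sub_ne_zero.2 hcc), one_smul]
    have h4 : Commute (X.proj k) Y.toMatrix := by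
      rw [h2]
      exact (hPY.sub_left ((Commute.one_left _).smul_left _)).smul_left _
    refine hXY (commute_toMatrix fun i => ?_)
    have hi : i ∈ ({k, l} : Finset a) := huniv ▸ Finset.mem_univ i
    rcases Finset.mem_insert.1 hi with rfl | hi
    · exact h4
    · rw [Finset.mem_singleton.1 hi, hl]
      exact (Commute.one_left _).sub_left h4

/-- Schur's lemma: the spectral projection of `H` at an eigenvalue commutes with `X` and `Y`, so it
is `0` or `1`; being nonzero it is `1`, and `H` is scalar. -/
theorem exists_smul_one_of_isHermitian [Nonempty a] {X Y : Observable a} (h : NoCommonBlock X Y)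
    {H : Matrix a a ℂ} (hH : H.IsHermitian) (hX : Commute H X.toMatrix)
    (hY : Commute H Y.toMatrix) : ∃ c : ℂ, H = c • (1 : Matrix a a ℂ) := by
  have hsa : IsSelfAdjoint H := hH
  obtain ⟨i⟩ := ‹Nonempty a›
  set lam := hH.eigenvalues i
  have hlam : lam ∈ spectrum ℝ H := hH.eigenvalues_mem_spectrum_real i
  set g : ℝ → ℝ := fun x => if x = lam then 1 else 0 with hg
  have hgc : ContinuousOn g (spectrum ℝ H) := continuousOn_spectrum g H
  have h1 : H * cfc g H = (lam : ℂ) • cfc g H := by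
    have h2 : cfc (fun x : ℝ => x * g x) H = H * cfc g H := by
      rw [cfc_mul _ _ H (continuousOn_spectrum _ _) hgc, cfc_id' ℝ H]
    have h3 : cfc (fun x : ℝ => lam * g x) H = lam • cfc g H := cfc_const_mul lam g H hgc
    rw [← h2, Complex.coe_smul, ← h3]
    refine cfc_congr fun x _ => ?_
    by_cases hx : x = lam <;> simp [hg, hx]
  have hPP : cfc g H * cfc g H = cfc g H := by
    rw [← cfc_mul g g H hgc hgc]
    refine cfc_congr fun x _ => ?_
    by_cases hx : x = lam <;> simp [hg, hx]
  rcases h (cfc g H) (cfc_predicate g H : IsSelfAdjoint _) hPP (hX.cfc_real g)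
    (hY.cfc_real g) with h0 | h0
  · exfalso
    -- By spectral mapping, `1` is in the spectrum of the projection, which excludes the zero
    -- matrix.
    have h2 := cfc_map_spectrum g H hsa hgc
    have h3 : (1 : ℝ) ∈ g '' spectrum ℝ H := ⟨lam, hlam, by simp [hg]⟩
    have : Nonempty a := ⟨i⟩
    rw [← h2, h0, spectrum.zero_eq] at h3
    exact one_ne_zero h3
  · rw [h0, Matrix.mul_one] at h1
    exact ⟨lam, h1⟩

theorem exists_smul_one_of_noCommonBlock [Nonempty a] {X Y : Observable a}
    (h : NoCommonBlock X Y) {M : Matrix a a ℂ} (hX : Commute M X.toMatrix)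
    (hY : Commute M Y.toMatrix) : ∃ c : ℂ, M = c • (1 : Matrix a a ℂ) := by
  have adj : ∀ {Z : Observable a}, Commute M Z.toMatrix → Commute Mᴴ Z.toMatrix := by
    intro Z hZ
    have h1 := congrArg Matrix.conjTranspose hZ.eq
    rw [conjTranspose_mul, conjTranspose_mul, (toMatrix_isHermitian Z).eq] at h1
    exact h1.symm
  obtain ⟨c, hc⟩ := exists_smul_one_of_isHermitian h (H := M + Mᴴ)
    (isHermitian_add_transpose_self M) (hX.add_left (adj hX)) (hY.add_left (adj hY))
  obtain ⟨c', hc'⟩ := exists_smul_one_of_isHermitian h (H := Complex.I • (M - Mᴴ))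
    (by
      rw [IsHermitian, conjTranspose_smul, conjTranspose_sub, conjTranspose_conjTranspose,
        Complex.star_def, Complex.conj_I]
      module)
    ((hX.sub_left (adj hX)).smul_left _) ((hY.sub_left (adj hY)).smul_left _)
  refine ⟨(c - Complex.I * c') / 2, ?_⟩
  have h1 : M = (1 / 2 : ℂ) • ((M + Mᴴ) - Complex.I • (Complex.I • (M - Mᴴ))) := by
    rw [smul_smul, Complex.I_mul_I]
    module
  rw [h1, hc, hc']
  module

/-- Each block of `ρ` between bystander basis vectors commutes with `X` and `Y`, so it is scalar.
Blocks need not be Hermitian, which is why the Schur lemma was extended through real and imaginary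
parts. Taking traces identifies the scalars as the entries of `reducedB ρ` divided by `d`. -/
theorem isMixedOnA_of_noCommonBlock [Nonempty a] {X Y : Observable a} (h : NoCommonBlock X Y)
    {ρ : Matrix (a × b) (a × b) ℂ} (hX : measure X ρ = ρ) (hY : measure Y ρ = ρ) :
    IsMixedOnA ρ := by
  have key : ∀ {Z : Observable a}, measure Z ρ = ρ → ∀ i j, Commute (slice ρ i j) Z.toMatrix := by
    intro Z hZ i j
    refine (commute_toMatrix (commute_proj_of_pinch_eq ?_)).symm
    rw [← slice_measure, hZ]
  have hd : (Fintype.card a : ℂ) ≠ 0 := by exact_mod_cast Fintype.card_ne_zero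
  refine slice_ext fun i j => ?_
  obtain ⟨c, hc⟩ := exists_smul_one_of_noCommonBlock h (key hX i j) (key hY i j)
  have h1 : reducedB ρ i j = Fintype.card a * c := by
    have h2 : reducedB ρ i j = (slice ρ i j).trace := rfl
    rw [h2, hc, trace_smul, trace_one, smul_eq_mul, mul_comm]
  have h3 : slice (((Fintype.card a : ℂ)⁻¹ • (1 : Matrix a a ℂ)) ⊗ₖ reducedB ρ) i j
      = ((Fintype.card a : ℂ)⁻¹ * reducedB ρ i j) • (1 : Matrix a a ℂ) := by
    ext k l
    simp [slice, one_apply, mul_comm]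
  rw [h3, hc, h1, inv_mul_cancel_left₀ hd]

end Measurement

/-! ### The maximally entangled state under measurement -/

section MaxEntangled

variable {a : Type} [Fintype a] [DecidableEq a]

theorem maxEntangled_eq : maxEntangled a = (Fintype.card a : ℂ)⁻¹ •
    vecMulVec (fun p : a × a => (1 : Matrix a a ℂ) p.1 p.2)
      (star fun p : a × a => (1 : Matrix a a ℂ) p.1 p.2) := by
  ext ⟨i, i'⟩ ⟨j, j'⟩
  simp [maxEntangled, vecMulVec_apply, one_apply, ite_and, apply_ite (starRingEnd ℂ)]
  split_ifs <;> rfl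

theorem star_uncurry_dotProduct (M N : Matrix a a ℂ) :
    (star fun p : a × a => M p.1 p.2) ⬝ᵥ (fun p : a × a => N p.1 p.2) = (Mᴴ * N).trace := by
  simp only [dotProduct, Pi.star_apply, trace, diag_apply, mul_apply, conjTranspose_apply,
    Fintype.sum_prod_type]
  exact Finset.sum_comm

/-- Read matrices as vectors of `H_A ⊗ H_A`: the state is `1/d` times the projector `|1⟩⟨1|` of the
vectorised identity, and `A_k ⊗ 1` sends that vector to the vectorised `A_k`. These vectors are
orthonormal for the trace inner product and sum to the vectorised identity, whatever the basis; the
two lemmas that follow on `measure A (maxEntangled a)` use exactly this. -/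
theorem measure_maxEntangled (A : Observable a) :
    measure A (maxEntangled a) = (Fintype.card a : ℂ)⁻¹ • ∑ k,
      vecMulVec (fun p : a × a => A.proj k p.1 p.2) (star fun p : a × a => A.proj k p.1 p.2) := by
  refine slice_ext fun i j => ?_
  have h : slice (maxEntangled a) i j = (Fintype.card a : ℂ)⁻¹ • Matrix.single i j 1 := by
    ext k l
    simp [slice, maxEntangled, Matrix.single_apply, eq_comm]
  rw [slice_measure, h, pinch_smul]
  ext k l
  simp only [pinch, slice, of_apply, Matrix.smul_apply, Matrix.sum_apply, vecMulVec_apply,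
    Pi.star_apply]
  congr 1
  refine Finset.sum_congr rfl fun q _ => ?_
  have h1 : star (A.proj q l j) = A.proj q j l := by
    rw [← conjTranspose_apply, proj_conjTranspose]
  rw [h1]
  simp [mul_apply, Matrix.single_apply, ite_and]

theorem isState_maxEntangled [Nonempty a] : IsState (maxEntangled a) := by
  have hd : (Fintype.card a : ℂ) ≠ 0 := by exact_mod_cast Fintype.card_ne_zero
  refine ⟨?_, ?_⟩
  · rw [maxEntangled_eq]
    have h := posSemidef_real_smul (posSemidef_vecMulVec_self_star
      (fun p : a × a => (1 : Matrix a a ℂ) p.1 p.2)) (c := (Fintype.card a : ℝ)⁻¹) (by positivity)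
    push_cast at h
    exact h
  · rw [maxEntangled_eq, trace_smul, trace_vecMulVec, dotProduct_comm, star_uncurry_dotProduct]
    simp [hd]

theorem maxEntangled_mul_self [Nonempty a] : maxEntangled a * maxEntangled a = maxEntangled a := by
  have hd : (Fintype.card a : ℂ) ≠ 0 := by exact_mod_cast Fintype.card_ne_zero
  rw [maxEntangled_eq, smul_mul_smul_comm, vecMulVec_mul_vecMulVec, star_uncurry_dotProduct]
  simp [hd, vecMulVec_smul, smul_smul]

theorem card_smul_measure_maxEntangled_sq [Nonempty a] (A : Observable a) :
    ((Fintype.card a : ℝ) : ℂ) • (measure A (maxEntangled a) * measure A (maxEntangled a))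
      = measure A (maxEntangled a) := by
  have hd : (Fintype.card a : ℂ) ≠ 0 := by exact_mod_cast Fintype.card_ne_zero
  rw [measure_maxEntangled, smul_mul_smul_comm, Finset.sum_mul]
  simp only [Finset.mul_sum, vecMulVec_mul_vecMulVec, star_uncurry_dotProduct,
    proj_conjTranspose, trace_proj_mul_proj, ite_smul, one_smul, zero_smul]
  simp [smul_smul, hd, apply_ite]

theorem card_smul_measure_maxEntangled_mul [Nonempty a] (A : Observable a) :
    ((Fintype.card a : ℝ) : ℂ) • (measure A (maxEntangled a) * maxEntangled a)
      = maxEntangled a := by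
  have hd : (Fintype.card a : ℂ) ≠ 0 := by exact_mod_cast Fintype.card_ne_zero
  have htr : ∀ k, (A.proj k).trace = 1 := fun k => by
    rw [← proj_mul_self, trace_proj_mul_proj, if_pos rfl]
  have hsum : ∑ k, (fun p : a × a => A.proj k p.1 p.2)
      = fun p : a × a => (1 : Matrix a a ℂ) p.1 p.2 := by
    rw [← sum_proj A]
    funext p
    simp [Matrix.sum_apply]
  rw [measure_maxEntangled, maxEntangled_eq, smul_mul_smul_comm, Finset.sum_mul]
  simp only [vecMulVec_mul_vecMulVec, star_uncurry_dotProduct, proj_conjTranspose,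
    Matrix.mul_one, htr, one_smul]
  have hv : ∀ v : a × a → ℂ, ∑ k, vecMulVec (fun p : a × a => A.proj k p.1 p.2) v
      = vecMulVec (∑ k, fun p : a × a => A.proj k p.1 p.2) v := fun v => by
    ext i j
    simp [vecMulVec_apply, Matrix.sum_apply, Finset.sum_mul]
  rw [hv, hsum]
  simp [smul_smul, hd]

end MaxEntangled

/-! ### From a similarity to the axioms -/

section Monotone

variable {f : ∀ (n : Type) [Fintype n] [DecidableEq n], Matrix n n ℂ → Matrix n n ℂ → ℝ}

/-- Joint concavity. -/
theorem IsSimilarity.sum_le (hf : IsSimilarity f) {n : Type} [Fintype n] [DecidableEq n]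
    {ι : Type} [Fintype ι] {p : ι → ℝ} {ρ σ : ι → Matrix n n ℂ} (hp : ∀ i, 0 ≤ p i)
    (hρ : ∀ i, (ρ i).PosSemidef) (hσ : ∀ i, (σ i).PosSemidef) :
    ∑ i, p i * f n (ρ i) (σ i) ≤ f n (∑ i, (p i : ℂ) • ρ i) (∑ i, (p i : ℂ) • σ i) := by
  classical
  have h1 : ∀ i, ((p i : ℂ) • ρ i).PosSemidef := fun i => posSemidef_real_smul (hρ i) (hp i)
  have h2 : ∀ i, ((p i : ℂ) • σ i).PosSemidef := fun i => posSemidef_real_smul (hσ i) (hp i)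
  -- The ensemble is stored in a classical register indexed by `ι`; tracing the register out
  -- produces the mixtures.
  have h := hf.partialTrace_le (posSemidef_blockDiagonal h1) (posSemidef_blockDiagonal h2)
  rw [partialTrace_blockDiagonal, partialTrace_blockDiagonal, hf.blockDiagonal h1 h2] at h
  simpa only [hf.smul (hρ _) (hσ _) (hp _)] using h

variable {a : Type} [Fintype a] [DecidableEq a] [Nonempty a]

/-- The loss attached to a similarity. -/
def IsLossOf (L : Quantifier a)
    (f : ∀ (n : Type) [Fintype n] [DecidableEq n], Matrix n n ℂ → Matrix n n ℂ → ℝ) : Prop :=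
  ∀ (b : Type) [Fintype b] [DecidableEq b] (A : Observable a) (ρ : Matrix (a × b) (a × b) ℂ),
    IsState ρ → L b A ρ = 1 / Real.sqrt (Fintype.card a) * (2 - 2 * f (a × b) ρ (measure A ρ))

theorem sqrt_card_pos : 0 < Real.sqrt (Fintype.card a) :=
  Real.sqrt_pos.2 (by exact_mod_cast Fintype.card_pos)

variable {L : Quantifier a}

section Loss

variable {b : Type} [Fintype b] [DecidableEq b] {A : Observable a}
  {ρ : Matrix (a × b) (a × b) ℂ}

theorem IsLossOf.nonneg (hL : IsLossOf L f) (hf : IsSimilarity f) (hρ : IsState ρ) :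
    0 ≤ L b A ρ := by
  rw [hL b A ρ hρ]
  have h := hf.le_one hρ (isState_measure A hρ)
  exact mul_nonneg (by positivity) (by linarith)

theorem IsLossOf.eq_zero_iff (hL : IsLossOf L f) (hf : IsSimilarity f) (hρ : IsState ρ) :
    L b A ρ = 0 ↔ measure A ρ = ρ := by
  have h0 : (1 / Real.sqrt (Fintype.card a)) ≠ 0 := (one_div_pos.2 sqrt_card_pos).ne'
  rw [hL b A ρ hρ, ← hf.eq_one_iff hρ (isState_measure A hρ), mul_eq_zero, or_iff_right h0]
  constructor <;> intro h <;> linarith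

theorem IsLossOf.le (hL : IsLossOf L f) (hf : IsSimilarity f) (hρ : IsState ρ) :
    L b A ρ ≤ 2 / Real.sqrt (Fintype.card a) * (1 - 1 / Real.sqrt (Fintype.card a)) := by
  have h := hf.inv_sqrt_le hρ (isState_measure A hρ) (by exact_mod_cast Fintype.card_pos)
    (posSemidef_card_smul_measure_sub A hρ.1)
  rw [hL b A ρ hρ]
  have h0 := one_div_pos.2 (sqrt_card_pos (a := a))
  rw [← mul_one_div 2]
  nlinarith

theorem IsLossOf.maxEntangled (hL : IsLossOf L f) (hf : IsSimilarity f) :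
    L a A (maxEntangled a)
      = 2 / Real.sqrt (Fintype.card a) * (1 - 1 / Real.sqrt (Fintype.card a)) := by
  rw [hL a A _ isState_maxEntangled, hf.eq_inv_sqrt isState_maxEntangled
    (isState_measure A isState_maxEntangled) (by exact_mod_cast Fintype.card_pos)
    maxEntangled_mul_self (card_smul_measure_maxEntangled_sq A)
    (card_smul_measure_maxEntangled_mul A)]
  ring

theorem IsState.submatrix {n m : Type} [Fintype n] [Fintype m] {σ : Matrix n n ℂ}
    (hσ : IsState σ) (e : m ≃ n) : IsState (σ.submatrix e e) :=
  ⟨hσ.1.submatrix e, by rw [trace_submatrix_equiv, hσ.2]⟩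

/-- Needed because `maxRealism` ranges over bystanders `Fin m`, whereas the maximally entangled
state has bystander `a`. -/
theorem IsLossOf.submatrix (hL : IsLossOf L f) (hf : IsSimilarity f) (hρ : IsState ρ)
    {c : Type} [Fintype c] [DecidableEq c] (e : c ≃ b) :
    L c A (ρ.submatrix (Equiv.prodCongrRight fun _ => e) (Equiv.prodCongrRight fun _ => e))
      = L b A ρ := by
  rw [hL c A _ (hρ.submatrix _), hL b A ρ hρ, measure_submatrix,
    hf.submatrix _ hρ.1 (posSemidef_measure A hρ.1)]

/-- An observable diagonal in the given basis. -/
def stdObservable (a : Type) [Fintype a] [DecidableEq a] : Observable a where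
  basis := 1
  value k := (Fintype.equivFin a k : ℕ)
  value_injective k l h := (Fintype.equivFin a).injective (Fin.ext (by simpa using h))

theorem IsLossOf.maxRealism_eq (hL : IsLossOf L f) (hf : IsSimilarity f) :
    maxRealism L
      = 2 / Real.sqrt (Fintype.card a) * (1 - 1 / Real.sqrt (Fintype.card a)) := by
  refine IsGreatest.csSup_eq ⟨?_, ?_⟩
  · refine ⟨Fintype.card a, stdObservable a, _,
      isState_maxEntangled.submatrix (Equiv.prodCongrRight fun _ => (Fintype.equivFin a).symm), ?_⟩
    rw [hL.submatrix hf isState_maxEntangled, hL.maxEntangled hf]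
  · rintro r ⟨m, A, ρ, hρ, rfl⟩
    exact hL.le hf hρ

theorem isState_sum {n ι : Type} [Fintype n] [DecidableEq n] [Fintype ι] {p : ι → ℝ}
    {σ : ι → Matrix n n ℂ} (hp : ∀ i, 0 ≤ p i) (hp1 : ∑ i, p i = 1) (hσ : ∀ i, IsState (σ i)) :
    IsState (∑ i, (p i : ℂ) • σ i) := by
  refine ⟨posSemidef_sum _ fun i _ => posSemidef_real_smul (hσ i).1 (hp i), ?_⟩
  simp only [trace_sum, trace_smul, (hσ _).2, smul_eq_mul, mul_one]
  exact_mod_cast hp1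

theorem IsLossOf.convex (hL : IsLossOf L f) (hf : IsSimilarity f) {ι : Type} [Fintype ι]
    {p : ι → ℝ} {ρ : ι → Matrix (a × b) (a × b) ℂ} (hp : ∀ i, 0 ≤ p i) (hp1 : ∑ i, p i = 1)
    (hρ : ∀ i, IsState (ρ i)) :
    L b A (∑ i, (p i : ℂ) • ρ i) ≤ ∑ i, p i * L b A (ρ i) := by
  have h := hf.sum_le hp (fun i => (hρ i).1) (fun i => posSemidef_measure A (hρ i).1)
  rw [hL b A _ (isState_sum hp hp1 hρ), measure_sum]
  simp only [measure_smul, hL b A _ (hρ _)]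
  have e : ∑ i, p i * (1 / Real.sqrt (Fintype.card a) *
      (2 - 2 * f (a × b) (ρ i) (measure A (ρ i))))
      = 1 / Real.sqrt (Fintype.card a) *
        (2 * ∑ i, p i - 2 * ∑ i, p i * f (a × b) (ρ i) (measure A (ρ i))) := by
    simp only [Finset.mul_sum, ← Finset.sum_sub_distrib]
    exact Finset.sum_congr rfl fun i _ => by ring
  rw [e, hp1]
  have h0 := one_div_pos.2 (sqrt_card_pos (a := a))
  exact mul_le_mul_of_nonneg_left (by linarith) h0.le

end Loss

theorem IsLossOf.measurementAxiom (hL : IsLossOf L f) (hf : IsSimilarity f) :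
    MeasurementAxiom (realism L) (maxRealism L) := by
  intro b _ _ A ρ hρ
  have hm := isState_measure A hρ
  have h0 : L b A (measure A ρ) = 0 := (hL.eq_zero_iff hf hm).2 (measure_measure A ρ)
  refine ⟨fun ε h1 h2 => ?_, ?_, ?_⟩
  · have hp : ∀ i : Bool, 0 ≤ (fun i : Bool => if i then 1 - ε else ε) i := by
      intro i
      cases i <;> simp [h1, h2]
    have hs : ∀ i : Bool, IsState ((fun i : Bool => if i then ρ else measure A ρ) i) := by
      intro i
      cases i
      · exact hm
      · exact hρ
    have hp1 : ∑ i : Bool, (fun i : Bool => if i then 1 - ε else ε) i = 1 := by simp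
    have hmon : monitor A ε ρ = ∑ i : Bool, (((fun i : Bool => if i then 1 - ε else ε) i : ℝ) : ℂ)
        • (fun i : Bool => if i then ρ else measure A ρ) i := by
      simp only [Fintype.sum_bool, monitor, if_true, Bool.false_eq_true, if_false]
    have hst : IsState (monitor A ε ρ) := by
      rw [hmon]
      exact isState_sum hp hp1 hs
    have hc := hL.convex hf (A := A) hp hp1 hs
    rw [← hmon] at hc
    simp only [Fintype.sum_bool, if_true, Bool.false_eq_true, if_false, h0, mul_zero,
      add_zero] at hc
    have hn := hL.nonneg hf hρ (A := A)
    refine ⟨?_, ?_, ?_⟩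
    · simp only [realism, hL.maxRealism_eq hf]
      linarith [hL.le hf hρ (A := A)]
    · simp only [realism]
      nlinarith
    · simp only [realism, h0]
      linarith [hL.nonneg hf hst (A := A)]
  · simp only [realism, h0, sub_zero]
  · rw [← hL.eq_zero_iff hf hρ]
    simp only [realism, sub_eq_self]

theorem traceOut_eq {b x : Type} [Fintype b] [DecidableEq b] [Fintype x] [DecidableEq x]
    (ρ : Matrix (a × b × x) (a × b × x) ℂ) :
    traceOut ρ = partialTrace (ρ.submatrix (Equiv.prodAssoc a b x) (Equiv.prodAssoc a b x)) :=
  rfl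

theorem IsLossOf.discardAxiom (hL : IsLossOf L f) (hf : IsSimilarity f) :
    DiscardAxiom (realism L) := by
  intro b x _ _ _ _ A ρ hρ
  have hst : IsState (traceOut ρ) := isState_partialTrace (hρ.submatrix (Equiv.prodAssoc a b x))
  have h := hf.partialTrace_le (hρ.1.submatrix (Equiv.prodAssoc a b x))
    ((posSemidef_measure A hρ.1).submatrix (Equiv.prodAssoc a b x))
  rw [hf.submatrix _ hρ.1 (posSemidef_measure A hρ.1), ← traceOut_eq, ← traceOut_eq,
    ← measure_traceOut] at h
  simp only [realism, hL _ A _ hρ, hL _ A _ hst]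
  have h0 := one_div_pos.2 (sqrt_card_pos (a := a))
  have := mul_le_mul_of_nonneg_left h h0.le
  linarith

theorem IsLossOf.uncorrelatedAxiom (hL : IsLossOf L f) (hf : IsSimilarity f) :
    UncorrelatedAxiom (realism L) := by
  intro b c _ _ _ _ A ρ σ hρ hσ
  have hk : IsState (ρ ⊗ₖ σ) :=
    ⟨hρ.1.kronecker hσ.1, by rw [trace_kronecker, hρ.2, hσ.2, mul_one]⟩
  have hst : IsState (adjoin ρ σ) := hk.submatrix (Equiv.prodAssoc a b c).symm
  have hm := posSemidef_measure A hρ.1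
  have h : f (a × b × c) (adjoin ρ σ) (adjoin (measure A ρ) σ) = f (a × b) ρ (measure A ρ) := by
    rw [← hf.kronecker hρ.1 hm hσ]
    exact hf.submatrix (Equiv.prodAssoc a b c).symm hk.1 (hm.kronecker hσ.1)
  simp only [realism, hL _ A _ hρ, hL _ A _ hst, measure_adjoin, h]

theorem IsLossOf.uncertaintyAxiom (hL : IsLossOf L f) (hf : IsSimilarity f) :
    UncertaintyAxiom (realism L) (maxRealism L) := by
  intro b _ _ X Y ρ hρ
  have hX := hL.nonneg hf hρ (A := X)
  have hY := hL.nonneg hf hρ (A := Y)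
  have hiff : realism L b X ρ + realism L b Y ρ = 2 * maxRealism L ↔
      measure X ρ = ρ ∧ measure Y ρ = ρ := by
    rw [← hL.eq_zero_iff hf hρ, ← hL.eq_zero_iff hf hρ]
    simp only [realism]
    constructor
    · intro h
      constructor <;> linarith
    · rintro ⟨h1, h2⟩
      linarith
  refine ⟨?_, hiff, fun h => ?_, fun h h1 => ?_⟩
  · simp only [realism]
    linarith
  · exact hiff.2 ⟨measure_of_isMixedOnA X h, measure_of_isMixedOnA Y h⟩
  · obtain ⟨h2, h3⟩ := hiff.1 h1
    by_cases hc : Commute X.toMatrix Y.toMatrix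
    · exact Or.inl hc
    · exact Or.inr (isMixedOnA_of_noCommonBlock
        (h.elim (fun h4 => noCommonBlock_of_card_eq_two h4 hc) id) h2 h3)

theorem IsLossOf.mixingAxiom (hL : IsLossOf L f) (hf : IsSimilarity f) :
    MixingAxiom (realism L) := by
  intro b _ _ A ι _ p ρ hp hp1 hρ
  have h := hL.convex hf (A := A) hp hp1 hρ
  simp only [realism, mul_sub, Finset.sum_sub_distrib, ← Finset.sum_mul, hp1, one_mul]
  linarith

theorem IsLossOf.isMonotone (hL : IsLossOf L f) (hf : IsSimilarity f) :
    IsMonotone (realism L) (maxRealism L) where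
  measurement := hL.measurementAxiom hf
  discard := hL.discardAxiom hf
  uncorrelated := hL.uncorrelatedAxiom hf
  uncertainty := hL.uncertaintyAxiom hf
  mixing := hL.mixingAxiom hf

end Monotone

/-! ### The Bures and Hellinger losses in terms of similarities -/

section Losses

variable {n : Type} [Fintype n] [DecidableEq n]

theorem schattenNorm_one (M : Matrix n n ℂ) : schattenNorm 1 M = (mabs M).trace.re := by
  have hsa : IsSelfAdjoint (mabs M) := (posSemidef_mabs M).isHermitian
  simp only [schattenNorm, Real.rpow_one, div_one]
  rw [cfc_id' ℝ (mabs M)]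

theorem schattenNorm_two_sq (M : Matrix n n ℂ) : schattenNorm 2 M ^ 2 = (Mᴴ * M).trace.re := by
  have hsa : IsSelfAdjoint (mabs M) := (posSemidef_mabs M).isHermitian
  have h : cfc (fun x : ℝ => x ^ (2 : ℝ)) (mabs M) = Mᴴ * M := by
    simp only [Real.rpow_two]
    rw [cfc_pow_id (mabs M) 2, pow_two, mabs_mul_self]
  have h0 := (Complex.le_def.1 (posSemidef_conjTranspose_mul_self M).trace_nonneg).1
  rw [schattenNorm, h, ← Real.rpow_natCast, ← Real.rpow_mul h0]
  norm_num

variable (a : Type) [Fintype a] [DecidableEq a]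

theorem isLossOf_lossBures : IsLossOf (lossBures a) rootFidelity := by
  intro b _ _ A ρ hρ
  have h1 := rootFidelity_le_one hρ (isState_measure A hρ)
  have h0 := rootFidelity_nonneg ρ (measure A ρ)
  have h2 : fidelity ρ (measure A ρ) = rootFidelity (a × b) ρ (measure A ρ) ^ 2 := by
    rw [fidelity, schattenNorm_one, rootFidelity]
  -- The real roots cancel their squares because the root fidelity lies between zero and one, so
  -- that the radicand of the Bures distance is nonnegative.
  rw [lossBures, dBures, h2, Real.sqrt_sq h0, Real.sq_sqrt (by linarith)]

theorem isLossOf_lossHellinger : IsLossOf (lossHellinger a) affinity := by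
  intro b _ _ A ρ hρ
  rw [lossHellinger, dHellinger, schattenNorm_two_sq,
    re_trace_sub_sq hρ (isState_measure A hρ)]

end Losses

/-! ### Nonvanishing of the Schatten profile -/

section Profile

/-- The value, up to a factor, of `lossSchatten` at the state with eigenvalues `1 - (d - 1) α`
(simple) and `α`, the first one at the uniform superposition. -/
def schattenProfile (d p α : ℝ) : ℝ :=
  (d - 1) * |d⁻¹ * d⁻¹ - α| ^ p + |d⁻¹ * d⁻¹ - (1 - (d - 1) * α)| ^ p
    + ((d - 1) * (d - 1) + (d - 1)) * (d⁻¹ * d⁻¹) ^ p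
    - ((d - 1) * |d⁻¹ * α - α| ^ p + |d⁻¹ * (1 - (d - 1) * α) - (1 - (d - 1) * α)| ^ p
      + (d - 1) * (d - 1) * |d⁻¹ * α| ^ p + (d - 1) * |d⁻¹ * (1 - (d - 1) * α)| ^ p)

theorem two_mul_abs_rpow_le {p : ℝ} (hp : 1 ≤ p) (x y : ℝ) :
    2 * |x| ^ p ≤ |x + y| ^ p + |x - y| ^ p := by
  have h1 := (convexOn_rpow hp).2 (abs_nonneg (x + y)) (abs_nonneg (x - y))
    (by norm_num : (0 : ℝ) ≤ 1 / 2) (by norm_num : (0 : ℝ) ≤ 1 / 2) (by norm_num)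
  simp only [smul_eq_mul] at h1
  have h2 : |x| ≤ 1 / 2 * |x + y| + 1 / 2 * |x - y| := by
    have h3 : |2 * x| ≤ |x + y| + |x - y| := by
      have := abs_add_le (x + y) (x - y)
      rwa [show x + y + (x - y) = 2 * x by ring] at this
    rw [abs_mul, abs_two] at h3
    linarith
  have h4 := Real.rpow_le_rpow (abs_nonneg x) h2 (by linarith : 0 ≤ p)
  linarith

/-- Write `z^p = (z²)^(p/2)`: concavity of the outer power bounds the average by `(x² + y²)^(p/2)`,
and Bernoulli's inequality then makes the second difference quadratic in `y`. -/
theorem rpow_second_difference_le {p x y : ℝ} (hp : 1 ≤ p) (hp2 : p ≤ 2) (hx : 0 < x)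
    (hy : |y| ≤ x) : (x + y) ^ p + (x - y) ^ p ≤ 2 * x ^ p + 2 * x ^ p / x ^ 2 * y ^ 2 := by
  obtain ⟨hy1, hy2⟩ := abs_le.1 hy
  have h0 : ∀ z : ℝ, 0 ≤ z → z ^ p = (z ^ 2) ^ (p / 2) := by
    intro z hz
    rw [← Real.rpow_natCast, ← Real.rpow_mul hz]
    congr 1
    push_cast
    ring
  have h1 := (Real.concaveOn_rpow (by linarith : 0 ≤ p / 2) (by linarith : p / 2 ≤ 1)).2
    (sq_nonneg (x + y)) (sq_nonneg (x - y))
    (by norm_num : (0 : ℝ) ≤ 1 / 2) (by norm_num : (0 : ℝ) ≤ 1 / 2) (by norm_num)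
  simp only [smul_eq_mul] at h1
  rw [← h0 _ (by linarith), ← h0 _ (by linarith)] at h1
  have h2 : 1 / 2 * (x + y) ^ 2 + 1 / 2 * (x - y) ^ 2 = x ^ 2 * (1 + y ^ 2 / x ^ 2) := by
    field_simp
    ring
  rw [h2, Real.mul_rpow (by positivity) (by positivity), ← h0 x hx.le] at h1
  have h3 := rpow_one_add_le_one_add_mul_self
    (by have : 0 ≤ y ^ 2 / x ^ 2 := by positivity
        linarith : (-1 : ℝ) ≤ y ^ 2 / x ^ 2) (by linarith : 0 ≤ p / 2) (by linarith : p / 2 ≤ 1)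
  have h4 : (1 + y ^ 2 / x ^ 2) ^ (p / 2) ≤ 1 + y ^ 2 / x ^ 2 := by
    have h5 : 0 ≤ y ^ 2 / x ^ 2 := by positivity
    nlinarith
  have h5 := mul_le_mul_of_nonneg_left h4 (Real.rpow_nonneg hx.le p)
  have h6 : x ^ p * (1 + y ^ 2 / x ^ 2) = x ^ p + x ^ p / x ^ 2 * y ^ 2 := by
    field_simp
  rw [h6] at h5
  have h7 : 2 * x ^ p / x ^ 2 * y ^ 2 = 2 * (x ^ p / x ^ 2 * y ^ 2) := by ring
  rw [h7]
  linarith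

theorem not_forall_rpow_le {p C r : ℝ} (hp2 : p < 2) (hr : 0 < r) :
    ¬ ∀ s : ℝ, 0 < s → s ≤ r → s ^ p ≤ C * s ^ 2 := by
  intro h
  have hlim : Filter.Tendsto (fun s : ℝ => C * s ^ (2 - p)) (nhdsWithin 0 (Set.Ioi 0))
      (nhds 0) := by
    have h1 := (Real.continuousAt_rpow_const 0 (2 - p) (Or.inr (by linarith))).tendsto
    rw [Real.zero_rpow (by linarith)] at h1
    have h2 := (h1.mono_left (nhdsWithin_le_nhds (s := Set.Ioi 0))).const_mul C
    rwa [mul_zero] at h2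
  have h1 : (1 : ℝ) ≤ 0 := by
    refine ge_of_tendsto hlim ?_
    filter_upwards [Ioc_mem_nhdsGT hr] with s hs
    have h2 := h s hs.1 hs.2
    have h3 : s ^ (2 - p) = s ^ 2 / s ^ p := by
      rw [Real.rpow_sub hs.1, Real.rpow_two]
    rw [h3, ← mul_div_assoc, le_div_iff₀ (Real.rpow_pos_of_pos hs.1 p), one_mul]
    exact h2
  linarith

theorem schattenProfile_zero_pos {d p : ℝ} (hd : 2 ≤ d) (hp2 : 2 ≤ p) :
    0 < schattenProfile d p 0 := by
  have hp : 1 < p := by linarith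
  have hd0 : 0 < d := by linarith
  set u := d⁻¹ with hu
  have hu0 : 0 < u := inv_pos.2 hd0
  have hdu : d * u = 1 := mul_inv_cancel₀ hd0.ne'
  have hu2 : u ≤ 1 / 2 := by
    rw [hu, one_div]
    exact inv_anti₀ (by norm_num) hd
  have hp0 : p ≠ 0 := by linarith
  simp only [schattenProfile, ← hu, mul_zero, sub_zero, abs_zero, Real.zero_rpow hp0, mul_one,
    zero_add]
  have e1 : |u * u - 1| = (1 - u) * (1 + u) := by
    rw [abs_of_nonpos (by nlinarith)]
    ring
  have e2 : |u - 1| = 1 - u := by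
    rw [abs_of_nonpos (by linarith)]
    ring
  rw [e1, e2, abs_of_pos hu0, abs_of_pos (mul_pos hu0 hu0),
    Real.mul_rpow (x := 1 - u) (y := 1 + u) (by linarith) (by linarith)]
  have hw := Real.rpow_pos_of_pos (mul_pos hu0 hu0) p
  have hb := one_add_mul_self_le_rpow_one_add (by linarith : (-1 : ℝ) ≤ u) hp.le
  have hv := Real.rpow_pos_of_pos (by linarith : 0 < 1 - u) p
  -- At `α = 0` the state is pure on `H_A`. The difference `(1 - u²)^p - (1 - u)^p` is at least `(1
  -- - u)^p p u` by Bernoulli, which exceeds or equals the negative term `(d - 1) u^p` because `u ≤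
  -- 1 - u` and `p (1 - u) ≥ 1`. The powers of `u²` left over are strictly positive.
  have h1 : (1 - u) ^ p * (p * u) ≤ (1 - u) ^ p * ((1 + u) ^ p - 1) :=
    mul_le_mul_of_nonneg_left (by linarith) hv.le
  have hm : u ^ (p - 2) ≤ (1 - u) ^ (p - 2) :=
    Real.rpow_le_rpow hu0.le (by linarith) (by linarith)
  have e3 : u ^ p = u ^ (p - 2) * u ^ 2 := by
    rw [← Real.rpow_two, ← Real.rpow_add hu0]
    congr 1
    ring
  have e4 : (1 - u) ^ p = (1 - u) ^ (p - 2) * (1 - u) ^ 2 := by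
    rw [← Real.rpow_two, ← Real.rpow_add (by linarith)]
    congr 1
    ring
  have hq := Real.rpow_pos_of_pos hu0 (p - 2)
  have h2 : (d - 1) * u ^ p ≤ (1 - u) ^ p * (p * u) := by
    have h3 : (d - 1) * u ^ p = u ^ (p - 2) * (u * (1 - u)) := by
      rw [e3]
      linear_combination u ^ (p - 2) * u * hdu
    rw [h3, e4, mul_assoc]
    refine mul_le_mul hm ?_ (by nlinarith)
      (Real.rpow_nonneg (by linarith) _)
    have h4 : 1 ≤ (1 - u) * p := by nlinarith
    have h5 : (1 - u) ^ 2 * (p * u) = u * (1 - u) * ((1 - u) * p) := by ring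
    rw [h5]
    exact le_mul_of_one_le_right (by nlinarith) h4
  have h3 : 0 < (d - 1) * (u * u) ^ p := mul_pos (by linarith) hw
  have h4 : 0 < ((d - 1) * (d - 1) + (d - 1)) * (u * u) ^ p := mul_pos (by nlinarith) hw
  linarith

theorem not_forall_schattenProfile_eq_zero {d p : ℝ} (hd : 2 ≤ d) (hp : 1 < p) (hp2 : p < 2) :
    ¬ ∀ α : ℝ, 0 ≤ α → α ≤ d⁻¹ → schattenProfile d p α = 0 := by
  intro hcon
  have hd0 : 0 < d := by linarith
  set u := d⁻¹ with hu
  have hu0 : 0 < u := inv_pos.2 hd0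
  have hdu : d * u = 1 := mul_inv_cancel₀ hd0.ne'
  have hu2 : u ≤ 1 / 2 := by
    rw [hu, one_div]
    exact inv_anti₀ (by norm_num) hd
  have hp0 : p ≠ 0 := by linarith
  -- `β` is the simple eigenvalue at `α = u²`, the point where the term `|u² - α|^p` is singular for
  -- `p < 2`. Vanishing of the profile is examined at `α = u² ± s` and `α = u²`.
  set β := 1 - (d - 1) * (u * u) with hβ
  have hduu : d * (u * u) = u := by rw [← mul_assoc, hdu, one_mul]
  have hβ' : β = 1 - u + u * u := by rw [hβ]; linarith
  have hβ0 : 0 < β := by nlinarith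
  set K₁ := (d - 1) * (1 - u) ^ p + (d - 1) * (d - 1) * u ^ p with hK₁
  set K₂ := (1 - u) ^ p + (d - 1) * u ^ p with hK₂
  have hup := Real.rpow_nonneg hu0.le p
  have hvp := Real.rpow_nonneg (by linarith : 0 ≤ 1 - u) p
  have hd1 : 0 < d - 1 := by linarith
  have hK₁0 : 0 ≤ K₁ := by positivity
  have hK₂0 : 0 ≤ K₂ := by positivity
  -- The vanishing profile with its negative terms moved across. They combine into powers of the two
  -- eigenvalues, which stay away from zero for small `s`, with coefficients `K₁` and `K₂`.
  have hform : ∀ s : ℝ, |s| ≤ u * u → (d - 1) * |s| ^ p + |β - u * u - (d - 1) * s| ^ p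
      + ((d - 1) * (d - 1) + (d - 1)) * (u * u) ^ p
      = K₁ * (u * u + s) ^ p + K₂ * (β - (d - 1) * s) ^ p := by
    intro s hs
    obtain ⟨hs1, hs2⟩ := abs_le.1 hs
    have hb : 0 ≤ β - (d - 1) * s := by nlinarith
    have ha : 0 ≤ u * u + s := by linarith
    have h := hcon (u * u + s) ha (by nlinarith)
    have eb : 1 - (d - 1) * (u * u + s) = β - (d - 1) * s := by rw [hβ]; ring
    have t1 : |u * u - (u * u + s)| = |s| := by
      rw [← abs_neg]
      congr 1
      ring
    have t2 : |u * u - (β - (d - 1) * s)| = |β - u * u - (d - 1) * s| := by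
      rw [← abs_neg]
      congr 1
      ring
    have t3 : ∀ z : ℝ, 0 ≤ z → |u * z - z| ^ p = (1 - u) ^ p * z ^ p := by
      intro z hz
      rw [← Real.mul_rpow (by linarith) hz, ← abs_neg, abs_of_nonneg (by nlinarith)]
      congr 1
      ring
    have t4 : ∀ z : ℝ, 0 ≤ z → |u * z| ^ p = u ^ p * z ^ p := by
      intro z hz
      rw [← Real.mul_rpow hu0.le hz, abs_of_nonneg (by positivity)]
    simp only [schattenProfile, ← hu, eb, t1, t2] at h
    rw [t3 _ ha, t3 _ hb, t4 _ ha, t4 _ hb] at h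
    rw [hK₁, hK₂]
    linarith
  set C₁ := 2 * (u * u) ^ p / (u * u) ^ 2 with hC₁
  set C₂ := 2 * β ^ p / β ^ 2 with hC₂
  -- Take second differences in `s`: the left side gives `2 (d - 1) s^p` plus a convex, hence
  -- nonnegative, contribution, while the right side is `O(s²)`. This is impossible near zero.
  refine not_forall_rpow_le (p := p)
    (C := (K₁ * C₁ + K₂ * C₂ * (d - 1) ^ 2) / (2 * (d - 1))) hp2 (mul_pos hu0 hu0) ?_
  intro s hs hsr
  have hs' : |s| ≤ u * u := by rwa [abs_of_pos hs]
  have f1 := hform s hs'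
  have f2 := hform (-s) (by rwa [abs_neg])
  have f0 := hform 0 (by rw [abs_zero]; positivity)
  have g1 := two_mul_abs_rpow_le hp.le (β - u * u) ((d - 1) * s)
  have hds : |(d - 1) * s| ≤ β := by
    rw [abs_of_pos (by positivity)]
    nlinarith
  have g2 := mul_le_mul_of_nonneg_left
    (rpow_second_difference_le hp.le hp2.le (mul_pos hu0 hu0) hs') hK₁0
  have g3 := mul_le_mul_of_nonneg_left
    (rpow_second_difference_le hp.le hp2.le hβ0 hds) hK₂0
  simp only [abs_zero, Real.zero_rpow hp0, mul_zero, sub_zero, add_zero, zero_add, abs_neg,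
    mul_neg, sub_neg_eq_add, ← sub_eq_add_neg, abs_of_pos hs] at f0 f1 f2
  rw [← hC₁] at g2
  rw [← hC₂] at g3
  rw [div_mul_eq_mul_div, le_div_iff₀ (by positivity)]
  have e1 : ((d - 1) * s) ^ 2 = (d - 1) ^ 2 * s ^ 2 := by ring
  rw [e1] at g3
  linear_combination f1 + f2 - 2 * f0 + g1 + g2 + g3

theorem exists_schattenProfile_ne_zero {d p : ℝ} (hd : 2 ≤ d) (hp : 1 < p) :
    ∃ α : ℝ, 0 ≤ α ∧ α ≤ d⁻¹ ∧ schattenProfile d p α ≠ 0 := by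
  rcases le_or_gt 2 p with hp2 | hp2
  · exact ⟨0, le_rfl, by positivity, (schattenProfile_zero_pos hd hp2).ne'⟩
  · by_contra hcon
    push Not at hcon
    exact not_forall_schattenProfile_eq_zero hd hp hp2 hcon

end Profile

/-! ### Functional calculus along an orthogonal resolution of the identity -/

section Resolutions

variable {n m ι κ : Type} [Fintype n] [DecidableEq n] [Fintype m] [DecidableEq m]
  [Fintype ι] [DecidableEq ι] [Fintype κ] [DecidableEq κ]

/-- An orthogonal resolution of the identity. -/
structure IsResolution (Q : ι → Matrix n n ℂ) : Prop where
  isHermitian : ∀ i, (Q i).IsHermitian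
  mul : ∀ i j, Q i * Q j = if i = j then Q i else 0
  sum : ∑ i, Q i = 1

namespace IsResolution

variable {Q : ι → Matrix n n ℂ}

theorem posSemidef (hQ : IsResolution Q) (i : ι) : (Q i).PosSemidef := by
  have h := posSemidef_conjTranspose_mul_self (Q i)
  rwa [(hQ.isHermitian i).eq, hQ.mul, if_pos rfl] at h

theorem sum_mul_sum (hQ : IsResolution Q) (c c' : ι → ℂ) :
    (∑ i, c i • Q i) * ∑ i, c' i • Q i = ∑ i, (c i * c' i) • Q i := by
  rw [Finset.sum_mul]
  refine Finset.sum_congr rfl fun i _ => ?_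
  simp [Finset.mul_sum, hQ.mul, smul_smul, mul_comm]

theorem isHermitian_sum (hQ : IsResolution Q) (c : ι → ℝ) :
    (∑ i, (c i : ℂ) • Q i).IsHermitian := by
  rw [IsHermitian, conjTranspose_sum]
  refine Finset.sum_congr rfl fun i _ => ?_
  rw [conjTranspose_smul, (hQ.isHermitian i).eq]
  simp

theorem posSemidef_sum (hQ : IsResolution Q) {c : ι → ℝ} (hc : ∀ i, 0 ≤ c i) :
    (∑ i, (c i : ℂ) • Q i).PosSemidef :=
  Matrix.posSemidef_sum _ fun i _ => posSemidef_real_smul (hQ.posSemidef i) (hc i)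

theorem aeval_sum (hQ : IsResolution Q) (c : ι → ℝ) (q : Polynomial ℝ) :
    Polynomial.aeval (∑ i, (c i : ℂ) • Q i) q = ∑ i, ((q.eval (c i) : ℝ) : ℂ) • Q i := by
  induction q using Polynomial.induction_on with
  | C r =>
    rw [Polynomial.aeval_C]
    simp only [Polynomial.eval_C, ← Finset.smul_sum, hQ.sum]
    rw [Algebra.algebraMap_eq_smul_one, Complex.coe_smul]
  | add q q' h h' =>
    simp only [map_add, h, h', Polynomial.eval_add, Complex.ofReal_add, add_smul,
      Finset.sum_add_distrib]
  | monomial k r h =>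
    rw [pow_succ, ← mul_assoc, map_mul, h, Polynomial.aeval_X, hQ.sum_mul_sum]
    simp [mul_assoc]

theorem cfc_sum (hQ : IsResolution Q) (c : ι → ℝ) (g : ℝ → ℝ) :
    cfc g (∑ i, (c i : ℂ) • Q i) = ∑ i, (g (c i) : ℂ) • Q i := by
  classical
  set M := ∑ i, (c i : ℂ) • Q i with hM
  have hsa : IsSelfAdjoint M := hQ.isHermitian_sum c
  -- Interpolate at the spectrum and at all coefficients `c i`. Some `Q i` may vanish, so a
  -- coefficient need not be an eigenvalue; including both sets avoids the distinction.
  set s : Finset ℝ := M.finite_real_spectrum.toFinset ∪ Finset.univ.image c with hs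
  set q := Lagrange.interpolate s id g with hq
  have heval : ∀ x ∈ s, q.eval x = g x := fun x hx =>
    Lagrange.eval_interpolate_at_node g (Set.injOn_id _) hx
  have h1 : cfc g M = cfc (fun x => q.eval x) M :=
    cfc_congr fun x hx => (heval x (Finset.mem_union_left _
      ((Set.Finite.mem_toFinset _).2 hx))).symm
  rw [h1]
  have h2 : cfc (fun x => q.eval x) M = Polynomial.aeval M q := cfc_polynomial q M hsa
  rw [h2, hM, hQ.aeval_sum]
  refine Finset.sum_congr rfl fun i _ => ?_
  rw [heval _ (Finset.mem_union_right _ (Finset.mem_image_of_mem c (Finset.mem_univ i)))]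

theorem mabs_sum (hQ : IsResolution Q) (c : ι → ℝ) :
    mabs (∑ i, (c i : ℂ) • Q i) = ∑ i, ((|c i| : ℝ) : ℂ) • Q i := by
  refine mabs_eq (hQ.posSemidef_sum fun i => abs_nonneg (c i)) ?_
  rw [(hQ.isHermitian_sum c).eq, hQ.sum_mul_sum, hQ.sum_mul_sum]
  refine Finset.sum_congr rfl fun i _ => ?_
  rw [← Complex.ofReal_mul, ← Complex.ofReal_mul, abs_mul_abs_self]

/-- The trace of `Q i` is the multiplicity of the coefficient `c i`, so a Schatten norm is read off
without diagonalising. -/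
theorem schattenNorm_rpow (hQ : IsResolution Q) (c : ι → ℝ) {p : ℝ} (hp : 0 < p) :
    schattenNorm p (∑ i, (c i : ℂ) • Q i) ^ p = ∑ i, |c i| ^ p * (Q i).trace.re := by
  have h0 : ∀ i, 0 ≤ (Q i).trace.re := fun i =>
    (Complex.le_def.1 (hQ.posSemidef i).trace_nonneg).1
  have h1 : (cfc (fun x : ℝ => x ^ p) (mabs (∑ i, (c i : ℂ) • Q i))).trace.re
      = ∑ i, |c i| ^ p * (Q i).trace.re := by
    rw [hQ.mabs_sum, hQ.cfc_sum, trace_sum, Complex.re_sum]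
    refine Finset.sum_congr rfl fun i _ => ?_
    rw [trace_smul, smul_eq_mul, Complex.re_ofReal_mul]
  have h2 : 0 ≤ ∑ i, |c i| ^ p * (Q i).trace.re :=
    Finset.sum_nonneg fun i _ => mul_nonneg (Real.rpow_nonneg (abs_nonneg _) _) (h0 i)
  rw [schattenNorm, h1, ← Real.rpow_mul h2, one_div_mul_cancel hp.ne', Real.rpow_one]

theorem kronecker {R : κ → Matrix m m ℂ} (hQ : IsResolution Q) (hR : IsResolution R) :
    IsResolution fun i : ι × κ => Q i.1 ⊗ₖ R i.2 where
  isHermitian i := by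
    rw [IsHermitian, conjTranspose_kronecker, (hQ.isHermitian _).eq, (hR.isHermitian _).eq]
  mul i j := by
    rw [← mul_kronecker_mul, hQ.mul, hR.mul]
    by_cases h1 : i.1 = j.1 <;> by_cases h2 : i.2 = j.2 <;> simp [h1, h2, Prod.ext_iff]
  sum := by
    rw [← one_kronecker_one, ← hQ.sum, ← hR.sum, Fintype.sum_prod_type]
    ext ⟨i, j⟩ ⟨k, l⟩
    simp [Matrix.sum_apply, Finset.sum_mul_sum]

theorem kronecker_one (hQ : IsResolution Q) :
    IsResolution fun i => Q i ⊗ₖ (1 : Matrix m m ℂ) where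
  isHermitian i := by
    rw [IsHermitian, conjTranspose_kronecker, (hQ.isHermitian _).eq, conjTranspose_one]
  mul i j := by
    rw [← mul_kronecker_mul, hQ.mul, Matrix.mul_one]
    split_ifs <;> simp
  sum := by
    rw [← one_kronecker_one, ← hQ.sum]
    ext ⟨i, j⟩ ⟨k, l⟩
    simp [Matrix.sum_apply, Finset.sum_mul]

end IsResolution

/-- The two spectral projections of a projection. -/
def boolProj (P : Matrix n n ℂ) (s : Bool) : Matrix n n ℂ := if s then P else 1 - P

theorem isResolution_boolProj {P : Matrix n n ℂ} (hP : P.IsHermitian) (hPP : P * P = P) :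
    IsResolution (boolProj P) where
  isHermitian s := by
    cases s
    · exact isHermitian_one.sub hP
    · exact hP
  mul s t := by
    cases s <;> cases t <;> simp [boolProj, Matrix.mul_sub, Matrix.sub_mul, hPP]
  sum := by simp [boolProj]

end Resolutions

/-! ### Mixtures of the uniform superposition with the maximally mixed state -/

section Superposition

variable (a : Type) [Fintype a] [DecidableEq a] [Nonempty a]

/-- The projection onto the uniform superposition of the basis vectors. -/
def uniformProj : Matrix a a ℂ := Matrix.of fun _ _ => (Fintype.card a : ℂ)⁻¹

theorem card_ne_zero_complex : (Fintype.card a : ℂ) ≠ 0 := by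
  exact_mod_cast Fintype.card_ne_zero

theorem isResolution_uniformProj : IsResolution (boolProj (uniformProj a)) := by
  refine isResolution_boolProj ?_ ?_
  · ext i j
    simp [uniformProj]
  · ext i j
    simp [uniformProj, mul_apply]

theorem isResolution_single (e₀ : a) :
    IsResolution (boolProj (Matrix.single e₀ e₀ (1 : ℂ))) := by
  refine isResolution_boolProj ?_ ?_
  · rw [IsHermitian, conjTranspose_single, star_one]
  · simp

theorem trace_boolProj_uniformProj (s : Bool) :
    (boolProj (uniformProj a) s).trace
      = (((if s then 1 else (Fintype.card a : ℝ) - 1) : ℝ) : ℂ) := by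
  have h : (uniformProj a).trace = 1 := by
    simp [uniformProj, trace]
  cases s <;> simp [boolProj, h]

theorem trace_boolProj_single (e₀ : a) (s : Bool) :
    (boolProj (Matrix.single e₀ e₀ (1 : ℂ)) s).trace
      = (((if s then 1 else (Fintype.card a : ℝ) - 1) : ℝ) : ℂ) := by
  cases s <;> simp [boolProj]

/-- The eigenvalue of `mixedState` at the uniform superposition or at its complement. -/
def mixedValue (α : ℝ) (s : Bool) : ℝ := if s then 1 - ((Fintype.card a : ℝ) - 1) * α else α

/-- A mixture of the uniform superposition and the maximally mixed state, with a maximally mixed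
bystander. -/
def mixedState (b : Type) [Fintype b] [DecidableEq b] (α : ℝ) : Matrix (a × b) (a × b) ℂ :=
  (∑ s, (mixedValue a α s : ℂ) • boolProj (uniformProj a) s) ⊗ₖ
    ((Fintype.card b : ℂ)⁻¹ • (1 : Matrix b b ℂ))

variable {a} (b : Type) [Fintype b] [DecidableEq b] {α : ℝ}

theorem mixedValue_nonneg (h0 : 0 ≤ α) (h1 : α ≤ (Fintype.card a : ℝ)⁻¹) (s : Bool) :
    0 ≤ mixedValue a α s := by
  have hd : (0 : ℝ) < Fintype.card a := by exact_mod_cast Fintype.card_pos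
  cases s
  · simpa [mixedValue] using h0
  · have h2 : (Fintype.card a : ℝ) * α ≤ 1 := by
      have := mul_le_mul_of_nonneg_left h1 hd.le
      rwa [mul_inv_cancel₀ hd.ne'] at this
    simp only [mixedValue, if_true]
    nlinarith

theorem isState_mixedState [Nonempty b] (h0 : 0 ≤ α) (h1 : α ≤ (Fintype.card a : ℝ)⁻¹) :
    IsState (mixedState a b α) := by
  have hb : (Fintype.card b : ℂ) ≠ 0 := card_ne_zero_complex b
  refine ⟨?_, ?_⟩
  · refine ((isResolution_uniformProj a).posSemidef_sum (mixedValue_nonneg h0 h1)).kronecker ?_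
    have h := posSemidef_real_smul (PosSemidef.one : (1 : Matrix b b ℂ).PosSemidef)
      (c := (Fintype.card b : ℝ)⁻¹) (by positivity)
    push_cast at h
    exact h
  · rw [mixedState, trace_kronecker, trace_smul, trace_one, smul_eq_mul, inv_mul_cancel₀ hb,
      mul_one, trace_sum]
    simp only [trace_smul, trace_boolProj_uniformProj, Fintype.sum_bool, mixedValue]
    simp
    ring

theorem pinch_stdObservable (M : Matrix a a ℂ) :
    pinch (stdObservable a) M = diagonal fun i => M i i := by
  have h : ∀ k, (stdObservable a).proj k = Matrix.single k k 1 := by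
    intro k
    rw [proj_eq]
    simp [stdObservable]
  ext i j
  simp only [pinch, h, single_mul_mul_single, Matrix.sum_apply, one_mul, mul_one,
    Matrix.single_apply, diagonal_apply]
  simp [ite_and]

theorem slice_kronecker (M : Matrix a a ℂ) (N : Matrix b b ℂ) (i j : b) :
    slice (M ⊗ₖ N) i j = N i j • M := by
  ext k l
  simp [slice, mul_comm]

/-- In the standard basis all diagonal entries on `H_A` are `1/d`, independently of `α`, and the
measurement keeps only these. -/
theorem measure_mixedState :
    measure (stdObservable a) (mixedState a b α)
      = ((Fintype.card a : ℂ)⁻¹ • (1 : Matrix a a ℂ)) ⊗ₖ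
        ((Fintype.card b : ℂ)⁻¹ • (1 : Matrix b b ℂ)) := by
  have hd := card_ne_zero_complex a
  refine slice_ext fun i j => ?_
  rw [slice_measure, mixedState, slice_kronecker, slice_kronecker, pinch_smul,
    pinch_stdObservable]
  congr 1
  ext k l
  rw [diagonal_apply, Matrix.smul_apply, one_apply]
  split_ifs
  · simp [mixedValue, boolProj, uniformProj]
    field_simp
    ring
  · simp

/-- The family is stable under adjoining a maximally mixed system, so Axiom 2(b) would compare
members that differ only in the dimension of the bystander. -/
theorem adjoin_mixedState (c : Type) [Fintype c] [DecidableEq c] :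
    adjoin (mixedState a b α) ((Fintype.card c : ℂ)⁻¹ • (1 : Matrix c c ℂ))
      = mixedState a (b × c) α := by
  rw [adjoin, mixedState, kronecker_assoc, mixedState, ← one_kronecker_one]
  simp only [smul_kronecker, kronecker_smul, smul_smul, Fintype.card_prod, Nat.cast_mul, mul_inv]
  rw [mul_comm]

/-- The weight `w` serves two losses: `w = 1` for Hilbert–Schmidt and `w = 1/d` for the trace
distance. -/
theorem measure_mixedState_sub (w : ℝ) :
    (w : ℂ) • measure (stdObservable a) (mixedState a b α) - mixedState a b α
      = ∑ s, (((w * (Fintype.card a : ℝ)⁻¹ - mixedValue a α s) * (Fintype.card b : ℝ)⁻¹ : ℝ) : ℂ)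
        • (boolProj (uniformProj a) s ⊗ₖ (1 : Matrix b b ℂ)) := by
  rw [measure_mixedState, mixedState]
  ext ⟨i, j⟩ ⟨k, l⟩
  simp only [Fintype.sum_bool, boolProj, if_true, Bool.false_eq_true, if_false,
    Matrix.sub_apply, Matrix.smul_apply, Matrix.add_apply, kronecker_apply, smul_eq_mul]
  push_cast
  ring

theorem schattenNorm_measure_mixedState_sub (w : ℝ) {p : ℝ} (hp : 0 < p) :
    schattenNorm p ((w : ℂ) • measure (stdObservable a) (mixedState a b α) - mixedState a b α) ^ p
      = ∑ s, |(w * (Fintype.card a : ℝ)⁻¹ - mixedValue a α s) * (Fintype.card b : ℝ)⁻¹| ^ p *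
        ((if s then 1 else (Fintype.card a : ℝ) - 1) * Fintype.card b) := by
  rw [measure_mixedState_sub, (isResolution_uniformProj a).kronecker_one.schattenNorm_rpow _ hp]
  refine Finset.sum_congr rfl fun s _ => ?_
  rw [trace_kronecker, trace_boolProj_uniformProj, trace_one, Complex.re_ofReal_mul,
    Complex.natCast_re]

theorem measure_mixedState_ne (hd : 2 ≤ Fintype.card a) [Nonempty b]
    (hα : α ≠ (Fintype.card a : ℝ)⁻¹) :
    measure (stdObservable a) (mixedState a b α) ≠ mixedState a b α := by
  intro h
  have hdC := card_ne_zero_complex a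
  have hbC := card_ne_zero_complex b
  obtain ⟨k, l, hkl⟩ := Fintype.exists_pair_of_one_lt_card (by omega : 1 < Fintype.card a)
  obtain ⟨j⟩ := ‹Nonempty b›
  have h1 := congrFun (congrFun h (k, j)) (l, j)
  rw [measure_mixedState] at h1
  simp only [mixedState, kronecker_apply, Matrix.smul_apply, one_apply_ne hkl, one_apply_eq,
    smul_eq_mul, mul_zero, zero_mul, mul_one, Fintype.sum_bool, Matrix.add_apply, boolProj,
    if_true, Bool.false_eq_true, if_false, Matrix.sub_apply, uniformProj, of_apply,
    mixedValue, zero_sub] at h1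
  have h2 : (((1 - (Fintype.card a : ℝ) * α : ℝ)) : ℂ) = 0 := by
    have h3 := (mul_eq_zero.1 h1.symm).resolve_right (inv_ne_zero hbC)
    have h4 : (((1 - (Fintype.card a : ℝ) * α : ℝ)) : ℂ) * (Fintype.card a : ℂ)⁻¹ = 0 := by
      rw [← h3]
      push_cast
      ring
    exact (mul_eq_zero.1 h4).resolve_right (inv_ne_zero hdC)
  have h3 : 1 - (Fintype.card a : ℝ) * α = 0 := by exact_mod_cast h2
  exact hα (eq_inv_of_mul_eq_one_right (by linarith))

end Superposition

/-! ### Failure of the axioms for the other distances -/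

section Violations

variable {a : Type} [Fintype a] [DecidableEq a] [Nonempty a]

theorem not_measurementAxiom_lossTrace (hd : 2 ≤ Fintype.card a) :
    ¬ MeasurementAxiom (realism (lossTrace a)) (maxRealism (lossTrace a)) := by
  intro h
  have hdR : (2 : ℝ) ≤ Fintype.card a := by exact_mod_cast hd
  have hd0 : (0 : ℝ) < Fintype.card a := by linarith
  set u := (Fintype.card a : ℝ)⁻¹ with hu
  have hu0 : 0 < u := inv_pos.2 hd0
  have hdu : (Fintype.card a : ℝ) * u = 1 := mul_inv_cancel₀ hd0.ne'
  have hu2 : u ≤ 1 / 2 := by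
    rw [hu, one_div]
    exact inv_anti₀ (by norm_num) hdR
  -- At `α = 1/(2d)` both eigenvalues are at least `1/d²`, so `ρ ≥ Φ_A(ρ)/d`. The trace norm is then
  -- the trace difference `1 - 1/d`, the loss is zero, and yet `ρ` is not fixed, since `α ≠ 1/d`.
  have hst : IsState (mixedState a Unit (u / 2)) :=
    isState_mixedState Unit (by positivity) (by rw [← hu]; linarith)
  have h1 := (h Unit (stdObservable a) (mixedState a Unit (u / 2)) hst).2.2
  refine measure_mixedState_ne Unit hd (by rw [← hu]; intro h2; linarith) (h1.1 ?_)
  have h2 := schattenNorm_measure_mixedState_sub (a := a) Unit (α := u / 2) u (p := 1) one_pos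
  simp only [Real.rpow_one] at h2
  have h3 : lossTrace a Unit (stdObservable a) (mixedState a Unit (u / 2)) = 0 := by
    have h4 : ((Fintype.card a : ℂ)⁻¹) = ((u : ℝ) : ℂ) := by rw [hu]; push_cast; rfl
    rw [lossTrace, dSchatten, h4, h2]
    have e1 : |u * u - (1 - ((Fintype.card a : ℝ) - 1) * (u / 2))|
        = 1 - ((Fintype.card a : ℝ) - 1) * (u / 2) - u * u := by
      rw [abs_of_nonpos (by nlinarith)]
      ring
    have e2 : |u * u - u / 2| = u / 2 - u * u := by
      rw [abs_of_nonpos (by nlinarith)]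
      ring
    simp only [Fintype.sum_bool, mixedValue, if_true, Bool.false_eq_true, if_false,
      Fintype.card_unit, Nat.cast_one, inv_one, mul_one, ← hu, e1, e2]
    have e3 : ((Fintype.card a : ℝ) - 1) / (Fintype.card a : ℝ)
        = ((Fintype.card a : ℝ) - 1) * u := div_eq_mul_inv _ _
    rw [e3]
    linear_combination (-u - 1) * hdu
  rw [realism, h3, sub_zero]

theorem isState_maxMixed (c : Type) [Fintype c] [DecidableEq c] [Nonempty c] :
    IsState ((Fintype.card c : ℂ)⁻¹ • (1 : Matrix c c ℂ)) := by
  refine ⟨?_, ?_⟩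
  · have h := posSemidef_real_smul (PosSemidef.one : (1 : Matrix c c ℂ).PosSemidef)
      (c := (Fintype.card c : ℝ)⁻¹) (by positivity)
    push_cast at h
    exact h
  · rw [trace_smul, trace_one, smul_eq_mul, inv_mul_cancel₀ (card_ne_zero_complex c)]

theorem loss_mixedState_eq_of_uncorrelatedAxiom {L : Quantifier a}
    (h : UncorrelatedAxiom (realism L)) {α : ℝ} (h0 : 0 ≤ α) (h1 : α ≤ (Fintype.card a : ℝ)⁻¹) :
    L (Unit × Bool) (stdObservable a) (mixedState a (Unit × Bool) α)
      = L Unit (stdObservable a) (mixedState a Unit α) := by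
  have h2 := h Unit Bool (stdObservable a) _ _ (isState_mixedState Unit h0 h1)
    (isState_maxMixed Bool)
  rw [adjoin_mixedState] at h2
  simpa [realism] using h2

theorem not_uncorrelatedAxiom_lossHilbertSchmidt (hd : 2 ≤ Fintype.card a) :
    ¬ UncorrelatedAxiom (realism (lossHilbertSchmidt a)) := by
  intro h
  have hdR : (2 : ℝ) ≤ Fintype.card a := by exact_mod_cast hd
  have hd0 : (0 : ℝ) < Fintype.card a := by linarith
  have h1 := loss_mixedState_eq_of_uncorrelatedAxiom h le_rfl (inv_nonneg.2 hd0.le)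
  -- The squared distance carries the factor `|b|⁻² |b|`: eigenvalues shrink by `|b|` and
  -- multiplicities grow by `|b|`. It differs between bystanders of dimensions one and two.
  have h2 : ∀ (b : Type) [Fintype b] [DecidableEq b],
      lossHilbertSchmidt a b (stdObservable a) (mixedState a b 0)
        = 1 / (Fintype.card a : ℝ) * (((Fintype.card b : ℝ)⁻¹ ^ 2 * Fintype.card b) *
          (((Fintype.card a : ℝ)⁻¹ - 1) ^ 2
            + (Fintype.card a : ℝ)⁻¹ ^ 2 * ((Fintype.card a : ℝ) - 1))) := by
    intro b _ _
    have h3 := schattenNorm_measure_mixedState_sub (a := a) b (α := 0) 1 (p := 2) two_pos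
    simp only [Real.rpow_two, sq_abs, Complex.ofReal_one, one_smul, one_mul] at h3
    rw [lossHilbertSchmidt, dSchatten, h3]
    simp only [Fintype.sum_bool, mixedValue, if_true, Bool.false_eq_true, if_false]
    ring
  rw [h2, h2] at h1
  have h4 : 0 < ((Fintype.card a : ℝ)⁻¹ - 1) ^ 2
      + (Fintype.card a : ℝ)⁻¹ ^ 2 * ((Fintype.card a : ℝ) - 1) := by
    have : 0 < (Fintype.card a : ℝ)⁻¹ ^ 2 * ((Fintype.card a : ℝ) - 1) :=
      mul_pos (by positivity) (by linarith)
    positivity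
  have h5 := mul_left_cancel₀ (one_div_pos.2 hd0).ne' h1
  have h6 := mul_right_cancel₀ h4.ne' h5
  norm_num [Fintype.card_prod] at h6

theorem lossSchatten_mixedState (b : Type) [Fintype b] [DecidableEq b] {p : ℝ} (hp : 0 < p)
    (e₀ : a) (α : ℝ) :
    lossSchatten a p e₀ b (stdObservable a) (mixedState a b α)
      = (Fintype.card b : ℝ)⁻¹ ^ p * Fintype.card b * schattenProfile (Fintype.card a) p α := by
  set d : ℝ := (Fintype.card a : ℝ) with hd
  -- Both differences in the loss are diagonal in the same four projections: uniform superposition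
  -- or complement on `H_A`, and `e₀` or complement on the environment.
  set Q : Bool × Bool → Matrix ((a × b) × a) ((a × b) × a) ℂ := fun i =>
    (boolProj (uniformProj a) i.1 ⊗ₖ (1 : Matrix b b ℂ)) ⊗ₖ
      boolProj (Matrix.single e₀ e₀ (1 : ℂ)) i.2 with hQdef
  have hQ : IsResolution Q :=
    (isResolution_uniformProj a).kronecker_one.kronecker (isResolution_single a e₀)
  have htr : ∀ i, (Q i).trace.re
      = (if i.1 then 1 else d - 1) * Fintype.card b * (if i.2 then 1 else d - 1) := by
    intro i
    rw [hQdef, trace_kronecker, trace_kronecker, trace_boolProj_uniformProj,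
      trace_boolProj_single, trace_one, ← Complex.ofReal_natCast, ← Complex.ofReal_mul,
      ← Complex.ofReal_mul, Complex.ofReal_re]
  have e1 : measure (stdObservable a) (mixedState a b α) ⊗ₖ
        ((Fintype.card a : ℂ)⁻¹ • (1 : Matrix a a ℂ))
      - mixedState a b α ⊗ₖ Matrix.single e₀ e₀ (1 : ℂ)
      = ∑ i, ((((d⁻¹ * d⁻¹ - if i.2 then mixedValue a α i.1 else 0)
          * (Fintype.card b : ℝ)⁻¹ : ℝ)) : ℂ) • Q i := by
    rw [measure_mixedState, mixedState]
    ext ⟨⟨i, j⟩, k⟩ ⟨⟨i', j'⟩, k'⟩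
    simp only [hQdef, Fintype.sum_prod_type, Fintype.sum_bool, boolProj, if_true,
      Bool.false_eq_true, if_false, Matrix.sub_apply, Matrix.smul_apply, Matrix.add_apply,
      kronecker_apply, smul_eq_mul, hd]
    push_cast
    ring
  have e2 : mixedState a b α ⊗ₖ ((Fintype.card a : ℂ)⁻¹ • (1 : Matrix a a ℂ))
      - mixedState a b α ⊗ₖ Matrix.single e₀ e₀ (1 : ℂ)
      = ∑ i, ((((d⁻¹ * mixedValue a α i.1 - if i.2 then mixedValue a α i.1 else 0)
          * (Fintype.card b : ℝ)⁻¹ : ℝ)) : ℂ) • Q i := by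
    rw [mixedState]
    ext ⟨⟨i, j⟩, k⟩ ⟨⟨i', j'⟩, k'⟩
    simp only [hQdef, Fintype.sum_prod_type, Fintype.sum_bool, boolProj, if_true,
      Bool.false_eq_true, if_false, Matrix.sub_apply, Matrix.smul_apply, Matrix.add_apply,
      kronecker_apply, smul_eq_mul, hd]
    push_cast
    ring
  have hb : 0 ≤ (Fintype.card b : ℝ)⁻¹ := by positivity
  have hd2 : 0 ≤ d⁻¹ * d⁻¹ := mul_self_nonneg _
  rw [lossSchatten, dSchatten, dSchatten, e1, e2, hQ.schattenNorm_rpow _ hp,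
    hQ.schattenNorm_rpow _ hp]
  simp only [htr, abs_mul _ (Fintype.card b : ℝ)⁻¹, abs_of_nonneg hb,
    Real.mul_rpow (abs_nonneg _) hb, Fintype.sum_prod_type, Fintype.sum_bool, if_true,
    Bool.false_eq_true, if_false, sub_zero, mixedValue, ← hd, schattenProfile,
    abs_of_nonneg hd2]
  ring

theorem not_uncorrelatedAxiom_lossSchatten (hd : 2 ≤ Fintype.card a) {p : ℝ} (hp : 1 < p)
    (e₀ : a) : ¬ UncorrelatedAxiom (realism (lossSchatten a p e₀)) := by
  intro h
  obtain ⟨α, h0, h1, hne⟩ := exists_schattenProfile_ne_zero (d := Fintype.card a)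
    (by exact_mod_cast hd) hp
  have h2 := loss_mixedState_eq_of_uncorrelatedAxiom h h0 h1
  rw [lossSchatten_mixedState _ (by linarith), lossSchatten_mixedState _ (by linarith)] at h2
  have h3 := mul_right_cancel₀ hne h2
  -- With a nonzero profile, Axiom 2(b) would force the scaling factor `2^(1 - p)` to equal one,
  -- whereas it is smaller for `p > 1`.
  have h4 : (2 : ℝ)⁻¹ ^ p < 2⁻¹ := by
    have := Real.rpow_lt_rpow_of_exponent_gt (by norm_num : (0 : ℝ) < 2⁻¹)
      (by norm_num : (2 : ℝ)⁻¹ < 1) hp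
    rwa [Real.rpow_one] at this
  norm_num [Fintype.card_prod] at h3 h4
  linarith

end Violations

end

end QRealism

open QRealism in
theorem mainTheorem1 (a : Type) [Fintype a] [DecidableEq a] [Nonempty a] :
    -- the Bures and the Hellinger quantifiers are monotones
    IsMonotone (realism (lossBures a)) (maxRealism (lossBures a)) ∧
    IsMonotone (realism (lossHellinger a)) (maxRealism (lossHellinger a)) ∧
    -- the maximum is explicit, and it is the loss of the maximally entangled state
    maxRealism (lossBures a) =
      2 / Real.sqrt (Fintype.card a) * (1 - 1 / Real.sqrt (Fintype.card a)) ∧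
    maxRealism (lossHellinger a) =
      2 / Real.sqrt (Fintype.card a) * (1 - 1 / Real.sqrt (Fintype.card a)) ∧
    (∀ A : Observable a, maxRealism (lossBures a) = lossBures a a A (maxEntangled a)) ∧
    (∀ A : Observable a, maxRealism (lossHellinger a) = lossHellinger a a A (maxEntangled a)) ∧
    -- the quantifiers of the other distances are not monotones
    (2 ≤ Fintype.card a →
      ¬ MeasurementAxiom (realism (lossTrace a)) (maxRealism (lossTrace a)) ∧
      ¬ UncorrelatedAxiom (realism (lossHilbertSchmidt a)) ∧
      ∀ p : ℝ, 1 < p → p ≠ 2 → ∀ e₀ : a,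
        ¬ UncorrelatedAxiom (realism (lossSchatten a p e₀))) := by
  have hB := isLossOf_lossBures a
  have hH := isLossOf_lossHellinger a
  have fB := isSimilarity_rootFidelity
  have fH := isSimilarity_affinity
  refine ⟨hB.isMonotone fB, hH.isMonotone fH, hB.maxRealism_eq fB, hH.maxRealism_eq fH,
    fun A => ?_, fun A => ?_, fun hd => ⟨not_measurementAxiom_lossTrace hd,
      not_uncorrelatedAxiom_lossHilbertSchmidt hd,
      fun p hp _ e₀ => not_uncorrelatedAxiom_lossSchatten hd hp e₀⟩⟩
  · rw [hB.maxRealism_eq fB, hB.maxEntangled fB]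
  · rw [hH.maxRealism_eq fH, hH.maxEntangled fH]
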